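/- Let $G = S^1 \times SU(2)$ with Lie algebra $\mathfrak g$ (the left-invariant vector fields on $G$). A homogeneous complex structure on $G$ is a left-invariant one, i.e. a linear map $J:\mathfrak g\to\mathfrak g$ with $J^2=-1$ and $[JU,JV]-J[JU,V]-J[U,JV]-[U,V]=0$ for all $U,V\in\mathfrak g$. A homogeneous l.c.K. (locally conformally Kähler) structure compatible with $J$ is a left-invariant $2$-form $\Omega$ that is $J$-invariant, for which $h(U,V)=\Omega(JU,V)$ is a Riemannian metric, and which satisfies $d\Omega=\theta\wedge\Omega$ for some left-invariant closed $1$-form $\theta$ (the Lee form). The Lee field $\xi$ is defined by $h(\xi,\cdot)=\theta$, and the structure is of Vaisman type if $\nabla\xi=0$ for the Levi-Civita connection $\nabla$ of $h$. Then for every homogeneous complex structure $J$ on $G$: (1) There is a homogeneous l.c.K. structure $\Omega$ compatible with $J$, with Lee form $\theta$ and Lee field $\xi$ satisfying $h(\xi,\xi)=1$, such that $\Omega=-\theta\wedge\phi+d\phi$, where $\phi=h(J\xi,\cdot)$ is the Reeb form. (2) There is $\lambda\in\mathbb C$ with $|\lambda|\neq 0,1$ such that $(G,J)$ is biholomorphic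 to the primary Hopf surface $(\mathbb C^2\setminus\{0\})/\langle (z_1,z_2)\mapsto(\lambda z_1,\lambda z_2)\rangle$. (3) Every homogeneous l.c.K. structure on $G$ compatible with $J$ is of Vaisman type. -/

import Mathlib

open scoped Manifold ContDiff Matrix

noncomputable section

namespace HopfLCK

/-! ### The Lie group `S¹ × SU(2)` -/

instance finrank_complex_prod : Fact (Module.finrank ℝ (WithLp 2 (ℂ × ℂ)) = 3 + 1) := ⟨by
  rw [LinearEquiv.finrank_eq (WithLp.linearEquiv 2 ℝ (ℂ × ℂ)), Module.finrank_prod,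
    Complex.finrank_real_complex]⟩

/-- The unit sphere of `ℂ²`, with the Euclidean norm. -/
abbrev S3 : Type := Metric.sphere (0 : WithLp 2 (ℂ × ℂ)) 1

/-- The special unitary group `SU(2)`. -/
abbrev SU2 : Type := Matrix.specialUnitaryGroup (Fin 2) ℂ

lemma mem_S3_iff (p : WithLp 2 (ℂ × ℂ)) :
    p ∈ Metric.sphere (0 : WithLp 2 (ℂ × ℂ)) 1 ↔
      p.fst * (starRingEnd ℂ) p.fst + p.snd * (starRingEnd ℂ) p.snd = 1 := by
  rw [mem_sphere_zero_iff_norm, ← sq_eq_sq₀ (norm_nonneg _) zero_le_one,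
    WithLp.prod_norm_sq_eq_of_L2, Complex.mul_conj, Complex.mul_conj,
    Complex.normSq_eq_norm_sq, Complex.normSq_eq_norm_sq]
  norm_cast
  simp

/-- The matrix with first column `(z₁, z₂)` and second column `(-z̄₂, z̄₁)`. -/
def su2Matrix (z₁ z₂ : ℂ) : Matrix (Fin 2) (Fin 2) ℂ :=
  !![z₁, -(starRingEnd ℂ) z₂; z₂, (starRingEnd ℂ) z₁]

lemma su2Matrix_mem (p : S3) :
    su2Matrix p.1.fst p.1.snd ∈ Matrix.specialUnitaryGroup (Fin 2) ℂ := by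
  have h := (mem_S3_iff p.1).1 p.2
  rw [Matrix.mem_specialUnitaryGroup_iff, Matrix.mem_unitaryGroup_iff]
  constructor
  · ext i j
    fin_cases i <;> fin_cases j <;>
      simp [su2Matrix, Matrix.mul_apply, Fin.sum_univ_two, Matrix.star_apply] <;>
      first | ring1 | linear_combination h
  · simp [su2Matrix, Matrix.det_fin_two]
    linear_combination h

lemma su2_entries (A : SU2) :
    A.1 0 1 = -(starRingEnd ℂ) (A.1 1 0) ∧ A.1 1 1 = (starRingEnd ℂ) (A.1 0 0) := by
  obtain ⟨hu, hd⟩ := Matrix.mem_specialUnitaryGroup_iff.1 A.2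
  have h1 : star A.1 * A.1 = 1 := Matrix.mem_unitaryGroup_iff'.1 hu
  have h2 : A.1 * A.1.adjugate = 1 := by rw [Matrix.mul_adjugate, hd, one_smul]
  have h3 : star A.1 = A.1.adjugate := left_inv_eq_right_inv h1 h2
  rw [Matrix.adjugate_fin_two] at h3
  have h4 := congrFun (congrFun h3 0) 1
  have h5 := congrFun (congrFun h3 0) 0
  simp [Matrix.star_apply] at h4 h5
  constructor
  · rw [h4, neg_neg]
  · rw [h5]

lemma su2_mem_S3 (A : SU2) :
    (WithLp.toLp 2 (A.1 0 0, A.1 1 0) : WithLp 2 (ℂ × ℂ)) ∈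
      Metric.sphere (0 : WithLp 2 (ℂ × ℂ)) 1 := by
  rw [mem_S3_iff]
  have hd := (Matrix.mem_specialUnitaryGroup_iff.1 A.2).2
  rw [Matrix.det_fin_two, (su2_entries A).1, (su2_entries A).2] at hd
  simp only [WithLp.toLp_fst, WithLp.toLp_snd]
  linear_combination hd

/-- The standard identification of `SU(2)` with `S³`: a matrix is sent to its first column. -/
def su2Homeo : SU2 ≃ₜ S3 where
  toFun A := ⟨WithLp.toLp 2 (A.1 0 0, A.1 1 0), su2_mem_S3 A⟩
  invFun p := ⟨su2Matrix p.1.fst p.1.snd, su2Matrix_mem p⟩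
  left_inv A := by
    apply Subtype.ext
    ext i j
    fin_cases i <;> fin_cases j <;>
      simp [su2Matrix, (su2_entries A).1, (su2_entries A).2]
  right_inv p := by
    apply Subtype.ext
    exact WithLp.ofLp_injective 2 (by simp [su2Matrix]; rfl)
  continuous_toFun := by
    apply Continuous.subtype_mk
    apply (WithLp.prod_continuous_toLp 2 ℂ ℂ).comp
    exact ((continuous_subtype_val.matrix_elem 0 0).prodMk
      (continuous_subtype_val.matrix_elem 1 0))
  continuous_invFun := by
    apply Continuous.subtype_mk
    apply continuous_matrix
    intro i j
    have h : Continuous fun p : S3 => WithLp.ofLp p.1 :=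
      (WithLp.prod_continuous_ofLp 2 ℂ ℂ).comp continuous_subtype_val
    have h1 : Continuous fun p : S3 => p.1.fst := h.fst
    have h2 : Continuous fun p : S3 => p.1.snd := h.snd
    fin_cases i <;> fin_cases j <;> simp [su2Matrix] <;> fun_prop

/-- The manifold structure of `SU(2)`, carried over from the sphere `S³`. -/
instance : ChartedSpace (EuclideanSpace ℝ (Fin 3)) SU2 where
  atlas := {e | ∃ c ∈ atlas (EuclideanSpace ℝ (Fin 3)) S3,
    e = su2Homeo.toOpenPartialHomeomorph.trans c}
  chartAt A := su2Homeo.toOpenPartialHomeomorph.trans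
    (chartAt (EuclideanSpace ℝ (Fin 3)) (su2Homeo A))
  mem_chart_source A := by simp
  chart_mem_atlas A := ⟨_, chart_mem_atlas _ _, rfl⟩

instance : IsManifold (𝓡 3) ω SU2 where
  compatible := by
    rintro _ _ ⟨c, hc, rfl⟩ ⟨c', hc', rfl⟩
    have h := (contDiffGroupoid ω (𝓡 3)).compatible hc hc'
    refine (contDiffGroupoid ω (𝓡 3)).mem_of_eqOnSource h ?_
    rw [OpenPartialHomeomorph.trans_symm_eq_symm_trans_symm, OpenPartialHomeomorph.trans_assoc,
      ← OpenPartialHomeomorph.trans_assoc su2Homeo.toOpenPartialHomeomorph.symm]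
    refine OpenPartialHomeomorph.EqOnSource.trans' (Setoid.refl _) ?_
    rw [← Homeomorph.symm_toOpenPartialHomeomorph, ← Homeomorph.trans_toOpenPartialHomeomorph]
    simp

lemma extChartAt_su2 (A : SU2) : extChartAt (𝓡 3) A =
    su2Homeo.toEquiv.toPartialEquiv.trans (extChartAt (𝓡 3) (su2Homeo A)) := by
  simp only [extChartAt, OpenPartialHomeomorph.extend]
  exact PartialEquiv.trans_assoc _ _ _

lemma contMDiff_su2Homeo : ContMDiff (𝓡 3) (𝓡 3) ω su2Homeo := by
  rw [contMDiff_iff]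
  refine ⟨su2Homeo.continuous, fun A p => ?_⟩
  have h := (contMDiff_iff.1 (contMDiff_id (I := 𝓡 3) (n := ω) (M := S3))).2 (su2Homeo A) p
  rw [extChartAt_su2]
  refine (h.congr fun x _ => ?_).mono ?_
  · simp
  · intro x hx
    simpa using hx

lemma contMDiff_su2Homeo_symm : ContMDiff (𝓡 3) (𝓡 3) ω su2Homeo.symm := by
  rw [contMDiff_iff]
  refine ⟨su2Homeo.symm.continuous, fun p A => ?_⟩
  have h := (contMDiff_iff.1 (contMDiff_id (I := 𝓡 3) (n := ω) (M := S3))).2 p (su2Homeo A)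
  rw [extChartAt_su2]
  refine (h.congr fun x _ => ?_).mono ?_
  · simp
  · intro x hx
    simpa using hx

/-- A map into `SU(2)` is smooth as soon as its first column is. -/
lemma contMDiff_su2_of_column {E H M : Type*} [NormedAddCommGroup E] [NormedSpace ℝ E]
    [TopologicalSpace H] {I : ModelWithCorners ℝ E H} [TopologicalSpace M] [ChartedSpace H M]
    [IsManifold I ω M] {f : M → SU2}
    (h0 : ContMDiff I 𝓘(ℝ, ℂ) ω fun x => (f x).1 0 0)
    (h1 : ContMDiff I 𝓘(ℝ, ℂ) ω fun x => (f x).1 1 0) : ContMDiff I (𝓡 3) ω f := by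
  have hc : ContMDiff I 𝓘(ℝ, WithLp 2 (ℂ × ℂ)) ω
      fun x => (WithLp.toLp 2 ((f x).1 0 0, (f x).1 1 0) : WithLp 2 (ℂ × ℂ)) :=
    (WithLp.prodContinuousLinearEquiv 2 ℝ ℂ ℂ).symm.contDiff.contMDiff.comp
      (h0.prodMk_space h1)
  have hs : ContMDiff I (𝓡 3) ω fun x => su2Homeo (f x) :=
    hc.codRestrict_sphere fun x => su2_mem_S3 (f x)
  exact (contMDiff_su2Homeo_symm.comp hs).congr fun x => by simp

lemma contMDiff_su2_column :
    ContMDiff (𝓡 3) 𝓘(ℝ, ℂ × ℂ) ω fun A : SU2 => (A.1 0 0, A.1 1 0) :=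
  ((WithLp.prodContinuousLinearEquiv 2 ℝ ℂ ℂ).contDiff.contMDiff.comp
    (contMDiff_coe_sphere (n := 3))).comp contMDiff_su2Homeo

/-- The matrix entries are smooth functions on `SU(2)`. -/
lemma contMDiff_su2_entry (i j : Fin 2) :
    ContMDiff (𝓡 3) 𝓘(ℝ, ℂ) ω fun A : SU2 => A.1 i j := by
  have h0 : ContMDiff (𝓡 3) 𝓘(ℝ, ℂ) ω fun A : SU2 => A.1 0 0 :=
    contDiff_fst.contMDiff.comp contMDiff_su2_column
  have h1 : ContMDiff (𝓡 3) 𝓘(ℝ, ℂ) ω fun A : SU2 => A.1 1 0 :=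
    contDiff_snd.contMDiff.comp contMDiff_su2_column
  fin_cases i <;> fin_cases j
  · exact h0
  · exact (Complex.conjCLE.contDiff.neg.contMDiff.comp h1).congr fun A => (su2_entries A).1
  · exact h1
  · exact (Complex.conjCLE.contDiff.contMDiff.comp h0).congr fun A => (su2_entries A).2

instance : LieGroup (𝓡 3) ω SU2 where
  contMDiff_mul := by
    have hl (i j : Fin 2) : ContMDiff ((𝓡 3).prod (𝓡 3)) 𝓘(ℝ, ℂ) ω
        fun p : SU2 × SU2 => p.1.1 i j := (contMDiff_su2_entry i j).comp contMDiff_fst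
    have hr (i j : Fin 2) : ContMDiff ((𝓡 3).prod (𝓡 3)) 𝓘(ℝ, ℂ) ω
        fun p : SU2 × SU2 => p.2.1 i j := (contMDiff_su2_entry i j).comp contMDiff_snd
    have hm : ContDiff ℝ ω fun q : (ℂ × ℂ) × (ℂ × ℂ) =>
        q.1.1 * q.2.1 + q.1.2 * q.2.2 := by fun_prop
    have key (i : Fin 2) : ContMDiff ((𝓡 3).prod (𝓡 3)) 𝓘(ℝ, ℂ) ω
        fun p : SU2 × SU2 => (p.1 * p.2).1 i 0 :=
      (hm.contMDiff.comp (((hl i 0).prodMk_space (hl i 1)).prodMk_space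
        ((hr 0 0).prodMk_space (hr 1 0)))).congr fun p => by
          simp [Matrix.mul_apply, Fin.sum_univ_two]
    exact contMDiff_su2_of_column (key 0) (key 1)
  contMDiff_inv := by
    have key (i j : Fin 2) : ContMDiff (𝓡 3) 𝓘(ℝ, ℂ) ω fun A : SU2 => (A⁻¹).1 i j :=
      (Complex.conjCLE.contDiff.contMDiff.comp (contMDiff_su2_entry j i)).congr fun A => rfl
    exact contMDiff_su2_of_column (key 0 0) (key 1 0)

/-- The Lie group `S¹ × SU(2)`. -/
abbrev G : Type := Circle × SU2

/-- The model of the four-dimensional real manifold `S¹ × SU(2)`. -/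
abbrev modelG := (𝓡 1).prod (𝓡 3)

/-- The Lie algebra of `S¹ × SU(2)`: the left-invariant vector fields. -/
abbrev 𝔤 : Type := GroupLieAlgebra modelG G

/-! ### Hopf surfaces -/

/-- `W = ℂ² ∖ {0}`. -/
abbrev W : Type := {z : ℂ × ℂ // z ≠ 0}

lemma isOpenEmbedding_W : Topology.IsOpenEmbedding (Subtype.val : W → ℂ × ℂ) :=
  isOpen_ne.isOpenEmbedding_subtypeVal

instance : Nonempty W := ⟨⟨(1, 0), by simp⟩⟩

instance : LocallyCompactSpace W := isOpenEmbedding_W.locallyCompactSpace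

/-- `W` is an open subset of `ℂ²`, with the inclusion as its only chart. -/
instance : ChartedSpace (ℂ × ℂ) W := isOpenEmbedding_W.singletonChartedSpace

instance : IsManifold 𝓘(ℂ, ℂ × ℂ) ω W := isOpenEmbedding_W.isManifold_singleton

instance : ContinuousConstSMul ℂˣ W where
  continuous_const_smul a :=
    Continuous.subtype_mk (continuous_subtype_val.const_smul a) _

/-- A complex number `lam` with `|lam| ≠ 0, 1`. -/
abbrev Multiplier : Type := {lam : ℂˣ // ‖(lam : ℂ)‖ ≠ 1}

/-- The cyclic group of automorphisms of `W` generated by `(z₁, z₂) ↦ (lam z₁, lam z₂)`. -/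
abbrev Gam (lam : Multiplier) : Subgroup ℂˣ := Subgroup.zpowers lam.1

instance (lam : Multiplier) : ContinuousConstSMul (Gam lam) W where
  continuous_const_smul a := continuous_const_smul (a : ℂˣ)

/-- The group generated by `z ↦ lam z` acts freely. -/
instance (lam : Multiplier) : IsCancelSMul (Gam lam) W where
  left_cancel' a b c h := smul_left_cancel a h
  right_cancel' a b c h := by
    have h1 : ((a : ℂˣ) : ℂ) • c.1 = ((b : ℂˣ) : ℂ) • c.1 := congrArg Subtype.val h
    exact Subtype.ext (Units.ext (smul_left_injective ℂ c.2 h1))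

instance (lam : Multiplier) : ProperlyDiscontinuousSMul (Gam lam) W where
  finite_disjoint_inter_image {K L} hK hL := by
    have hlam : Real.log ‖(lam.1 : ℂ)‖ ≠ 0 :=
      Real.log_ne_zero_of_pos_of_ne_one (norm_pos_iff.2 lam.1.ne_zero) lam.2
    have hcont : Continuous fun z : W => Real.log ‖z.1‖ :=
      continuous_subtype_val.norm.log fun z => norm_ne_zero_iff.2 z.2
    obtain ⟨C, hC⟩ := (hK.union hL).exists_bound_of_continuousOn hcont.continuousOn
    obtain ⟨N, hN⟩ := exists_nat_gt (2 * C / |Real.log ‖(lam.1 : ℂ)‖|)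
    refine ((Set.finite_Icc (-(N : ℤ)) N).image fun n : ℤ =>
      (⟨lam.1 ^ n, n, rfl⟩ : Gam lam)).subset ?_
    rintro ⟨_, n, rfl⟩ ⟨_, ⟨z, hz, rfl⟩, hw⟩
    refine ⟨n, ?_, rfl⟩
    have h1 := hC z (Or.inl hz)
    have h2 := hC _ (Or.inr hw)
    have h3 : Real.log ‖((⟨lam.1 ^ n, n, rfl⟩ : Gam lam) • z).1‖ =
        n * Real.log ‖(lam.1 : ℂ)‖ + Real.log ‖z.1‖ := by
      change Real.log ‖((lam.1 ^ n : ℂˣ) : ℂ) • z.1‖ = _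
      rw [norm_smul, Real.log_mul (norm_ne_zero_iff.2 (lam.1 ^ n).ne_zero) (norm_ne_zero_iff.2 z.2), Units.val_zpow_eq_zpow_val,
        norm_zpow, Real.log_zpow]
    simp only [] at h2
    rw [h3] at h2
    rw [Real.norm_eq_abs, abs_le] at h1 h2
    have h4 : |(n : ℝ)| * |Real.log ‖(lam.1 : ℂ)‖| ≤ 2 * C := by
      rw [← abs_mul, abs_le]
      constructor <;> linarith
    rw [div_lt_iff₀ (abs_pos.2 hlam)] at hN
    have h5 : |(n : ℝ)| < N := lt_of_mul_lt_mul_right (h4.trans_lt hN) (abs_nonneg _)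
    have h6 : |n| < (N : ℤ) := by exact_mod_cast h5
    exact ⟨(abs_lt.1 h6).1.le, (abs_lt.1 h6).2.le⟩

/-- The primary Hopf surface `W / ⟨z ↦ lam z⟩`; its charts are the local inverses of the
projection from `W`. -/
abbrev HopfSurface (lam : Multiplier) : Type := MulAction.orbitRel.Quotient (Gam lam) W

/-- Changes of charts of the Hopf surface are locally multiplications by a power of `lam`. -/
lemma contDiffOn_transition (lam : Multiplier) (A A' : OpenPartialHomeomorph (HopfSurface lam) W)
    (hA : ⇑A.symm = Quotient.mk (MulAction.orbitRel (Gam lam) W))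
    (hA' : ⇑A'.symm = Quotient.mk (MulAction.orbitRel (Gam lam) W)) (w w' : W) :
    ContDiffOn ℂ ω ((A.trans (chartAt (ℂ × ℂ) w)).symm.trans (A'.trans (chartAt (ℂ × ℂ) w')))
      ((A.trans (chartAt (ℂ × ℂ) w)).symm.trans (A'.trans (chartAt (ℂ × ℂ) w'))).source := by
  intro x hx
  apply ContDiffAt.contDiffWithinAt
  set c := chartAt (ℂ × ℂ) w with hc
  have hcval (v : W) : c v = v.1 := rfl
  have hc'val (v : W) : chartAt (ℂ × ℂ) w' v = v.1 := rfl
  have hxc : x ∈ c.target := by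
    simp only [mfld_simps] at hx
    exact hx.1.1
  have hxA' : A.symm (c.symm x) ∈ A'.source := by
    simp only [mfld_simps] at hx
    exact hx.2
  set w₀ := c.symm x with hw₀
  have hπ : A'.symm (A' (A.symm w₀)) = A.symm w₀ := A'.left_inv hxA'
  rw [hA', hA] at hπ
  obtain ⟨a, ha⟩ := Quotient.exact hπ
  have hopen : IsOpen {v : W | a • v ∈ A'.target} :=
    A'.open_target.preimage (continuous_const_smul a)
  have hmem : w₀ ∈ {v : W | a • v ∈ A'.target} := by
    have h1 := A'.map_source hxA'
    rw [hA, ← ha] at h1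
    exact h1
  have hev : ∀ᶠ y in nhds x, c.symm y ∈ {v : W | a • v ∈ A'.target} :=
    (c.continuousAt_symm hxc).eventually_mem (hopen.mem_nhds hmem)
  have hev' : ∀ᶠ y in nhds x, y ∈ c.target := c.open_target.mem_nhds hxc
  have hsmooth : ContDiffAt ℂ ω (fun y : ℂ × ℂ => ((a : ℂˣ) : ℂ) • y) x := by fun_prop
  refine hsmooth.congr_of_eventuallyEq ?_
  filter_upwards [hev, hev'] with y hy hy'
  have h2 : A.symm (c.symm y) = A'.symm (a • c.symm y) := by
    rw [hA, hA']
    exact (Quotient.sound ⟨a, rfl⟩ : (Quotient.mk (MulAction.orbitRel (Gam lam) W)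
      (a • c.symm y)) = _).symm
  have h3 : (c.symm y).1 = y := c.right_inv hy'
  calc _ = (A' (A.symm (c.symm y))).1 := rfl
    _ = (a • c.symm y).1 := by rw [h2, A'.right_inv hy]
    _ = ((a : ℂˣ) : ℂ) • y := congrArg (((a : ℂˣ) : ℂ) • ·) h3

/-- The Hopf surface is a complex manifold. -/
instance (lam : Multiplier) : IsManifold 𝓘(ℂ, ℂ × ℂ) ω (HopfSurface lam) := by
  apply isManifold_of_contDiffOn
  rintro _ _ ⟨q, rfl⟩ ⟨q', rfl⟩
  exact (contDiffOn_transition lam _ _ (IsLocalHomeomorph.localInverseAt_symm _ _)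
    (IsLocalHomeomorph.localInverseAt_symm _ _) _ _).mono Set.inter_subset_left

/-- Multiplication by `i` on the tangent spaces of a manifold with charts in `ℂ²`; for a complex
manifold it does not depend on the charts. -/
def mulI {M : Type*} [TopologicalSpace M] [ChartedSpace (ℂ × ℂ) M] (p : M) :
    TangentSpace 𝓘(ℝ, ℂ × ℂ) p →L[ℝ] TangentSpace 𝓘(ℝ, ℂ × ℂ) p :=
  ((Complex.I • ContinuousLinearMap.id ℂ (ℂ × ℂ)).restrictScalars ℝ : (ℂ × ℂ) →L[ℝ] (ℂ × ℂ))

/-- A diffeomorphism `f : S¹ × SU(2) → M` is a biholomorphism, for the left-invariant complex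
structure on `S¹ × SU(2)` given by `J` on left-invariant vector fields, if `df ∘ J = i df`. (The
values at `g` of the left-invariant fields are all the tangent vectors at `g`.) -/
def IsBiholomorphism (J : 𝔤 →ₗ[ℝ] 𝔤) {M : Type*} [TopologicalSpace M] [ChartedSpace (ℂ × ℂ) M]
    (f : G ≃ₘ^∞⟮modelG, 𝓘(ℝ, ℂ × ℂ)⟯ M) : Prop :=
  ∀ (g : G) (U : 𝔤),
    mfderiv modelG 𝓘(ℝ, ℂ × ℂ) f g (mulInvariantVectorField (J U) g) =
      mulI (f g) (mfderiv modelG 𝓘(ℝ, ℂ × ℂ) f g (mulInvariantVectorField U g))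

/-! ### Left-invariant structures, as structures on the Lie algebra -/

section LieAlgebra

variable {L : Type*} [LieRing L] [LieAlgebra ℝ L]

/-- A complex structure on the Lie algebra: `J² = -1`, and the Nijenhuis tensor vanishes. -/
structure IsComplexStructure (J : L →ₗ[ℝ] L) : Prop where
  sq : ∀ U, J (J U) = -U
  nijenhuis : ∀ U V, ⁅J U, J V⁆ - J ⁅J U, V⁆ - J ⁅U, J V⁆ - ⁅U, V⁆ = 0

/-- The wedge product of two `1`-forms. -/
def wedge₁₁ (α β : Module.Dual ℝ L) (U V : L) : ℝ := α U * β V - α V * β U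

/-- The wedge product of a `1`-form and a `2`-form. -/
def wedge₁₂ (α : Module.Dual ℝ L) (Ω : LinearMap.BilinForm ℝ L) (U V Z : L) : ℝ :=
  α U * Ω V Z - α V * Ω U Z + α Z * Ω U V

/-- The exterior derivative of a left-invariant `1`-form. -/
def d₁ (α : Module.Dual ℝ L) (U V : L) : ℝ := -α ⁅U, V⁆

/-- The exterior derivative of a left-invariant `2`-form. -/
def d₂ (Ω : LinearMap.BilinForm ℝ L) (U V Z : L) : ℝ :=
  -Ω ⁅U, V⁆ Z + Ω ⁅U, Z⁆ V - Ω ⁅V, Z⁆ U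

/-- The metric `h(U, V) = Ω(J U, V)` with fundamental form `Ω`. -/
def metric (J : L →ₗ[ℝ] L) (Ω : LinearMap.BilinForm ℝ L) : LinearMap.BilinForm ℝ L :=
  Ω.comp J LinearMap.id

/-- `Ω` is the fundamental form of a left-invariant locally conformally Kähler structure that is
compatible with the complex structure `J`, and `θ` is its Lee form. -/
structure IsLCK (J : L →ₗ[ℝ] L) (Ω : LinearMap.BilinForm ℝ L) (θ : Module.Dual ℝ L) : Prop where
  alt : Ω.IsAlt
  invariant : ∀ U V, Ω (J U) (J V) = Ω U V
  pos : ∀ U, U ≠ 0 → 0 < metric J Ω U U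
  lee_closed : ∀ U V, d₁ θ U V = 0
  lck : ∀ U V Z, d₂ Ω U V Z = wedge₁₂ θ Ω U V Z

/-- `ξ` is the vector field associated with the `1`-form `θ` by the metric `h`. -/
def IsDualField (h : LinearMap.BilinForm ℝ L) (θ : Module.Dual ℝ L) (ξ : L) : Prop :=
  ∀ U, h ξ U = θ U

/-- `D U V = ∇_U V` is the Levi-Civita connection of the left-invariant metric `h`, on
left-invariant vector fields: it is metric and torsion free. -/
structure IsLeviCivita (h : LinearMap.BilinForm ℝ L) (D : L →ₗ[ℝ] L →ₗ[ℝ] L) : Prop where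
  torsion_free : ∀ U V, D U V - D V U = ⁅U, V⁆
  isMetric : ∀ U V Z, h (D U V) Z + h V (D U Z) = 0

/-- The structure with fundamental form `Ω` and Lee form `θ` is of Vaisman type: the Lee field is
parallel for the Levi-Civita connection. -/
def IsVaisman (J : L →ₗ[ℝ] L) (Ω : LinearMap.BilinForm ℝ L) (θ : Module.Dual ℝ L) : Prop :=
  ∃ (ξ : L) (D : L →ₗ[ℝ] L →ₗ[ℝ] L), IsDualField (metric J Ω) θ ξ ∧
    IsLeviCivita (metric J Ω) D ∧ ∀ U, D U ξ = 0

end LieAlgebra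

end HopfLCK

end

/-! The map z ↦ (exp(i log|z|), z/|z|) is a homomorphism from the nonzero quaternions to `G` and a
local diffeomorphism, so `𝔤` is the quaternions with the commutator
(`isQuaternionic_quaternionEquiv`); quaternions are written as pairs in ℂ², with ℂ² = span(1, i) ⊕
span(j, k).

Normal form (`exists_normalForm`). The imaginary part of J1 is nonzero, and an inner automorphism
makes J1 = a + bi with b ≠ 0. Since 1 is central, integrability says that J commutes with ad(J1) = b
ad(i). Hence J preserves the image span(j, k) of ad(i) and is ℂ-linear there, so it acts by i or -i;
conjugation by j exchanges the two signs. Only the real parameters a, b remain.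

(1) Take θ a multiple of the real part and φ = -θ∘J. Then dφ lives on span(j, k), and with the right
sign of θ the metric is θ² + φ² plus a positive multiple of the Euclidean metric of span(j, k). The
equation dΩ = θ ∧ Ω follows from dθ = 0 and d² = 0 (`exists_lck_of_normalForm`).

(2) The map (exp(is), A) ↦ exp(κs) A v is well defined modulo λ = exp(2πκ), and is a diffeomorphism
onto the Hopf surface if Re κ ≠ 0. A left translation of `G` corresponds to a ℂ-linear map of ℂ², so
holomorphy need only be checked at the identity, where it determines κ in terms of a and b
(`mfderiv_spiral_normalForm`).

(3) A closed θ vanishes on the commutators i, j, k. Then dΩ = θ ∧ Ω, J-invariance and positivity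
make span(1, i) and span(j, k) orthogonal for h. Hence ξ lies in span(1, i) and ad ξ is an
infinitesimal rotation of span(j, k): ξ is a Killing field. The covariant derivative of ξ is skew
because ξ is Killing and symmetric because θ is closed, so it vanishes
(`IsLCK.isVaisman_of_normalForm`). -/

noncomputable section

namespace HopfLCK

/-! ### The quaternion product on `ℂ²` -/

/-- The quaternion product on `ℂ²`: the first column of the product of the matrices with first
columns `z` and `w`. -/
def qmul (z w : ℂ × ℂ) : ℂ × ℂ :=
  (z.1 * w.1 - (starRingEnd ℂ) z.2 * w.2, z.2 * w.1 + (starRingEnd ℂ) z.1 * w.2)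

/-- The quaternion conjugation on `ℂ²`. -/
def qconj (z : ℂ × ℂ) : ℂ × ℂ := ((starRingEnd ℂ) z.1, -z.2)

/-- The square of the Euclidean norm on `ℂ²`. -/
def qnorm (z : ℂ × ℂ) : ℝ := Complex.normSq z.1 + Complex.normSq z.2

lemma qmul_assoc (z w x : ℂ × ℂ) : qmul (qmul z w) x = qmul z (qmul w x) := by
  ext1 <;> simp [qmul] <;> ring

lemma qmul_one (z : ℂ × ℂ) : qmul z (1, 0) = z := by
  ext1 <;> simp [qmul]

lemma one_qmul (z : ℂ × ℂ) : qmul (1, 0) z = z := by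
  ext1 <;> simp [qmul]

lemma qmul_add (z w x : ℂ × ℂ) : qmul z (w + x) = qmul z w + qmul z x := by
  ext1 <;> simp [qmul] <;> ring

lemma add_qmul (z w x : ℂ × ℂ) : qmul (z + w) x = qmul z x + qmul w x := by
  ext1 <;> simp [qmul] <;> ring

lemma qmul_smul (c : ℂ) (z w : ℂ × ℂ) : qmul z (c • w) = c • qmul z w := by
  ext1 <;> simp [qmul] <;> ring

lemma qmul_real_smul (c : ℝ) (z w : ℂ × ℂ) : qmul z (c • w) = c • qmul z w := by
  ext1 <;> simp [qmul] <;> ring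

lemma real_smul_qmul (c : ℝ) (z w : ℂ × ℂ) : qmul (c • z) w = c • qmul z w := by
  ext1 <;> simp [qmul] <;> ring

lemma qmul_qconj (z : ℂ × ℂ) : qmul z (qconj z) = ((qnorm z : ℂ), 0) := by
  ext1
  · simp [qmul, qconj, qnorm, Complex.mul_conj]
    rw [mul_comm, Complex.mul_conj]
  · simp [qmul, qconj]
    ring

lemma qconj_qmul (z : ℂ × ℂ) : qmul (qconj z) z = ((qnorm z : ℂ), 0) := by
  ext1
  · simp [qmul, qconj, qnorm]
    rw [← Complex.mul_conj, ← Complex.mul_conj]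
    ring
  · simp [qmul, qconj]
    ring

lemma qnorm_qmul (z w : ℂ × ℂ) : qnorm (qmul z w) = qnorm z * qnorm w := by
  apply Complex.ofReal_injective
  simp only [qnorm, qmul, Complex.ofReal_add, Complex.ofReal_mul, ← Complex.mul_conj]
  simp
  ring

lemma qnorm_smul (c : ℂ) (z : ℂ × ℂ) : qnorm (c • z) = Complex.normSq c * qnorm z := by
  simp [qnorm, mul_add]

lemma qnorm_qconj (z : ℂ × ℂ) : qnorm (qconj z) = qnorm z := by
  simp [qnorm, qconj]

lemma qnorm_pos {z : ℂ × ℂ} (hz : z ≠ 0) : 0 < qnorm z := by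
  rw [qnorm]
  by_cases h : z.1 = 0
  · have h2 : z.2 ≠ 0 := fun h2 => hz (Prod.ext h h2)
    have := Complex.normSq_pos.2 h2
    have := Complex.normSq_nonneg z.1
    linarith
  · have := Complex.normSq_pos.2 h
    have := Complex.normSq_nonneg z.2
    linarith

lemma ne_zero_of_qnorm_pos {z : ℂ × ℂ} (hz : 0 < qnorm z) : z ≠ 0 := by
  rintro rfl
  simp [qnorm] at hz

/-- Left multiplication of `ℂ²` by a quaternion. -/
def qmulLeft (z : ℂ × ℂ) : (ℂ × ℂ) →L[ℂ] (ℂ × ℂ) :=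
  LinearMap.toContinuousLinearMap
    { toFun := qmul z, map_add' := qmul_add z, map_smul' := fun c w => qmul_smul c z w }

@[simp] lemma qmulLeft_apply (z w : ℂ × ℂ) : qmulLeft z w = qmul z w := rfl

/-- Right multiplication of `ℂ²` by a quaternion. -/
def qmulRight (w : ℂ × ℂ) : (ℂ × ℂ) →L[ℝ] (ℂ × ℂ) :=
  LinearMap.toContinuousLinearMap
    { toFun := fun z => qmul z w
      map_add' := fun z x => add_qmul z x w
      map_smul' := fun c z => real_smul_qmul c z w }

@[simp] lemma qmulRight_apply (z w : ℂ × ℂ) : qmulRight w z = qmul z w := rfl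

/-- Conjugation by a quaternion of norm `1`. -/
def qAd (v : ℂ × ℂ) (hv : qnorm v = 1) : (ℂ × ℂ) ≃ₗ[ℝ] (ℂ × ℂ) where
  toFun z := qmul (qmul v z) (qconj v)
  invFun z := qmul (qmul (qconj v) z) v
  map_add' z w := by rw [qmul_add, add_qmul]
  map_smul' c z := by rw [qmul_real_smul, real_smul_qmul]; rfl
  left_inv z := by
    change qmul (qmul (qconj v) (qmul (qmul v z) (qconj v))) v = z
    rw [qmul_assoc, qmul_assoc, qconj_qmul, hv, Complex.ofReal_one, qmul_one, ← qmul_assoc,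
      qconj_qmul, hv, Complex.ofReal_one, one_qmul]
  right_inv z := by
    change qmul (qmul v (qmul (qmul (qconj v) z) v)) (qconj v) = z
    rw [qmul_assoc, qmul_assoc, qmul_qconj, hv, Complex.ofReal_one, qmul_one, ← qmul_assoc,
      qmul_qconj, hv, Complex.ofReal_one, one_qmul]

lemma qAd_apply (v : ℂ × ℂ) (hv : qnorm v = 1) (z : ℂ × ℂ) :
    qAd v hv z = qmul (qmul v z) (qconj v) := rfl

lemma qAd_qmul_self (v : ℂ × ℂ) (hv : qnorm v = 1) (z : ℂ × ℂ) :
    qmul (qAd v hv z) v = qmul v z := by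
  rw [qAd_apply, qmul_assoc, qconj_qmul, hv, Complex.ofReal_one, qmul_one]

lemma qAd_qmul (v : ℂ × ℂ) (hv : qnorm v = 1) (z w : ℂ × ℂ) :
    qAd v hv (qmul z w) = qmul (qAd v hv z) (qAd v hv w) := by
  rw [qAd_apply v hv w, ← qmul_assoc, ← qmul_assoc, qAd_qmul_self, qmul_assoc v, qAd_apply]

lemma qAd_one (v : ℂ × ℂ) (hv : qnorm v = 1) : qAd v hv (1, 0) = (1, 0) := by
  rw [qAd_apply, qmul_one, qmul_qconj, hv, Complex.ofReal_one]

lemma re_qAd (v : ℂ × ℂ) (hv : qnorm v = 1) (z : ℂ × ℂ) : (qAd v hv z).1.re = z.1.re := by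
  have h : (qAd v hv z).1.re = qnorm v * z.1.re := by
    simp [qAd_apply, qmul, qconj, qnorm, Complex.normSq_apply]
    ring
  rw [h, hv, one_mul]

/-- Every imaginary quaternion is conjugate to a multiple of `i`. -/
lemma exists_qAd_eq (r : ℝ) (w : ℂ) (h : (⟨0, r⟩, w) ≠ (0 : ℂ × ℂ)) :
    ∃ (v : ℂ × ℂ) (hv : qnorm v = 1) (b : ℝ), b ≠ 0 ∧ qAd v hv (⟨0, b⟩, 0) = (⟨0, r⟩, w) := by
  have hpos := qnorm_pos h
  set b : ℝ := √(qnorm (⟨0, r⟩, w)) with hb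
  have hb0 : 0 < b := Real.sqrt_pos.2 hpos
  have hb2 : b ^ 2 = r ^ 2 + Complex.normSq w := by
    rw [hb, Real.sq_sqrt hpos.le]
    simp [qnorm, Complex.normSq_apply]
    ring
  have hw := Complex.normSq_nonneg w
  -- Here the target is -bi, and conjugation by j does it; the general formula for v degenerates.
  by_cases hr : b + r = 0
  · have hr' : r = -b := by linarith
    have hw0 : w = 0 := by
      rw [← Complex.normSq_eq_zero]
      nlinarith
    refine ⟨(0, 1), by simp [qnorm], b, hb0.ne', ?_⟩
    rw [hr', hw0]
    ext1 <;> apply Complex.ext <;> simp [qAd_apply, qmul, qconj]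
  · have hrb : 0 < b + r := by
      have : -b ≤ r := (abs_le_of_sq_le_sq' (by nlinarith) hb0.le).1
      exact lt_of_le_of_ne (by linarith) (Ne.symm hr)
    -- For x = (ri, w) one has x² = -b², so v = b - xi satisfies v(bi) = xv. In coordinates v = (b +
    -- r, -iw), of square norm 2b(b + r); dividing by the norm gives (s, -iw/(2bs)).
    set s : ℝ := √((b + r) / (2 * b)) with hs
    have hs0 : 0 < s := Real.sqrt_pos.2 (by positivity)
    have hs2 : s ^ 2 = (b + r) / (2 * b) := Real.sq_sqrt (by positivity)
    have hs2' : 2 * b * s ^ 2 = b + r := by rw [hs2]; field_simp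
    have hq : qnorm ((s : ℂ), -Complex.I * w / (2 * b * s)) = 1 := by
      simp [qnorm]
      rw [← pow_two]
      field_simp
      nlinarith
    refine ⟨_, hq, b, hb0.ne', ?_⟩
    have hsC : (s : ℂ) ≠ 0 := by exact_mod_cast hs0.ne'
    have hbC : (b : ℂ) ≠ 0 := by exact_mod_cast hb0.ne'
    have e : (⟨0, b⟩ : ℂ) = Complex.I * b := by apply Complex.ext <;> simp
    have e' : (⟨0, r⟩ : ℂ) = Complex.I * r := by apply Complex.ext <;> simp
    have hs3 : 2 * (b : ℂ) * s ^ 2 = b + r := by exact_mod_cast hs2'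
    have hb3 : (b : ℂ) ^ 2 = r ^ 2 + w * (starRingEnd ℂ) w := by
      rw [Complex.mul_conj]
      exact_mod_cast hb2
    rw [e, e']
    ext1
    · simp [qAd_apply, qmul, qconj]
      field_simp
      rw [map_ofNat]
      linear_combination (2 * (b : ℂ) * s ^ 2 + b - r) * hs3 + hb3 +
        w * (starRingEnd ℂ) w * Complex.I_sq
    · simp [qAd_apply, qmul, qconj]
      field_simp
      ring_nf
      simp only [Complex.I_sq]
      ring

lemma qconj_qmul_rev (z w : ℂ × ℂ) : qconj (qmul z w) = qmul (qconj w) (qconj z) := by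
  ext1 <;> simp [qmul, qconj] <;> ring

lemma qAd_comp (v w : ℂ × ℂ) (hv : qnorm v = 1) (hw : qnorm w = 1) (hvw : qnorm (qmul v w) = 1)
    (z : ℂ × ℂ) : qAd (qmul v w) hvw z = qAd v hv (qAd w hw z) := by
  simp only [qAd_apply, qconj_qmul_rev, qmul_assoc]

/-! ### Normal form of a complex structure on the quaternions -/

section NormalForm

variable {L : Type*} [LieRing L] [LieAlgebra ℝ L]

/-- A linear isomorphism from the quaternions to `L` that carries the commutator to the Lie
bracket. -/
def IsQuaternionic (ι : (ℂ × ℂ) ≃ₗ[ℝ] L) : Prop :=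
  ∀ u w, ⁅ι u, ι w⁆ = ι (qmul u w - qmul w u)

lemma IsQuaternionic.qAd {ι : (ℂ × ℂ) ≃ₗ[ℝ] L} (hι : IsQuaternionic ι) (v : ℂ × ℂ)
    (hv : qnorm v = 1) : IsQuaternionic ((qAd v hv).trans ι) := fun u w => by
  simp only [LinearEquiv.trans_apply, hι _ _, map_sub, qAd_qmul]

/-- If `J 1` lies in the span of `1` and `i`, then `J` preserves the orthogonal complement of
that span, and acts there by multiplication by `i` or by `-i`. -/
lemma IsComplexStructure.apply_snd {ι : (ℂ × ℂ) ≃ₗ[ℝ] L} (hι : IsQuaternionic ι)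
    {J : L →ₗ[ℝ] L} (hJ : IsComplexStructure J) {a b : ℝ} (hb : b ≠ 0)
    (h1 : J (ι (1, 0)) = ι (⟨a, b⟩, 0)) :
    (∀ w, J (ι (0, w)) = ι (0, Complex.I * w)) ∨ (∀ w, J (ι (0, w)) = ι (0, -Complex.I * w)) := by
  set K : (ℂ × ℂ) →ₗ[ℝ] (ℂ × ℂ) := ι.symm.toLinearMap ∘ₗ J ∘ₗ ι.toLinearMap with hK
  have hJK (z) : J (ι z) = ι (K z) := by simp [hK]
  have hKK (z) : K (K z) = -z := by
    apply ι.injective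
    rw [← hJK, ← hJK, hJ.sq, map_neg]
  have hcomm (z : ℂ × ℂ) : K (0, -2 * b * Complex.I * z.2) =
      (0, -2 * b * Complex.I * (K z).2) := by
    -- Since 1 is central, the Nijenhuis condition reduces to [J1, JV] = J[J1, V].
    have h := hJ.nijenhuis (ι (1, 0)) (ι z)
    have h0 (y) : ⁅ι (1, 0), ι y⁆ = 0 := by rw [hι, one_qmul, qmul_one, sub_self, map_zero]
    have h2 (y) : ⁅ι (⟨a, b⟩, 0), ι y⁆ = ι (0, -2 * b * Complex.I * y.2) := by
      rw [hι]
      congr 1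
      have e : (⟨a, b⟩ : ℂ) = a + b * Complex.I := by apply Complex.ext <;> simp
      rw [e]
      ext1 <;> simp [qmul] <;> ring
    rw [hJK z, h0, h0, h1, h2, h2, map_zero, sub_zero, sub_zero, hJK, ← map_sub] at h
    exact (sub_eq_zero.1 ((map_eq_zero_iff ι ι.injective).1 h)).symm
  have hbC : (b : ℂ) ≠ 0 := by exact_mod_cast hb
  -- Every (0, w) is in the image of ad(J1), because b ≠ 0, and J preserves that image.
  have hfst (w : ℂ) : (K (0, w)).1 = 0 := by
    have h := congrArg Prod.fst (hcomm (0, w / (-2 * b * Complex.I)))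
    rwa [mul_div_cancel₀ _ (by simp [hbC])] at h
  set S : ℂ → ℂ := fun w => (K (0, w)).2 with hS
  have hKS (w : ℂ) : K (0, w) = (0, S w) := Prod.ext (hfst w) rfl
  have hreal (c : ℝ) (w : ℂ) : S (c * w) = c * S w := by
    have h : ((0 : ℂ), (c : ℂ) * w) = c • ((0 : ℂ), w) := by ext1 <;> simp
    simp only [hS, h, map_smul]
    simp
  have hadd (w x : ℂ) : S (w + x) = S w + S x := by
    have h : ((0 : ℂ), w + x) = (0, w) + (0, x) := by simp
    simp only [hS, h, map_add]
    simp
  have hI (w : ℂ) : S (Complex.I * w) = Complex.I * S w := by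
    have h := congrArg Prod.snd (hcomm (0, w))
    have e : -2 * (b : ℂ) * Complex.I * w = ((-2 * b : ℝ) : ℂ) * (Complex.I * w) := by
      push_cast; ring
    simp only [e] at h
    have h' : S (((-2 * b : ℝ) : ℂ) * (Complex.I * w)) = -2 * b * Complex.I * S w := h
    rw [hreal] at h'
    have h3 : (((-2 * b : ℝ) : ℂ)) ≠ 0 := by simp [hbC]
    apply mul_left_cancel₀ h3
    rw [h']
    push_cast; ring
  have hlin (w : ℂ) : S w = w * S 1 := by
    conv_lhs => rw [← Complex.re_add_im w, mul_comm (w.im : ℂ)]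
    have h1 := hreal w.re 1
    have h2 := hI ((w.im : ℂ) * 1)
    rw [hreal] at h2
    rw [mul_one] at h1 h2
    rw [hadd, h1, h2]
    conv_rhs => rw [← Complex.re_add_im w]
    ring
  have hsq : S 1 ^ 2 = Complex.I ^ 2 := by
    have h := hKK (0, 1)
    rw [hKS, hKS, hlin (S 1)] at h
    have := congrArg Prod.snd h
    simp only [Prod.snd_neg] at this
    rw [Complex.I_sq, pow_two, this]
  rcases sq_eq_sq_iff_eq_or_eq_neg.1 hsq with h | h
  · left
    intro w
    rw [hJK, hKS, hlin, h, mul_comm]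
  · right
    intro w
    rw [hJK, hKS, hlin, h, mul_comm]

/-- Up to an inner automorphism, a complex structure on the quaternions preserves the spans of
`1, i` and `j, k`, and acts on the second one by multiplication by `i`. -/
lemma IsComplexStructure.exists_normalForm {ι : (ℂ × ℂ) ≃ₗ[ℝ] L} (hι : IsQuaternionic ι)
    {J : L →ₗ[ℝ] L} (hJ : IsComplexStructure J) :
    ∃ (v : ℂ × ℂ) (hv : qnorm v = 1) (a b : ℝ), b ≠ 0 ∧
      J (ι (qAd v hv (1, 0))) = ι (qAd v hv (⟨a, b⟩, 0)) ∧
      ∀ w, J (ι (qAd v hv (0, w))) = ι (qAd v hv (0, Complex.I * w)) := by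
  obtain ⟨⟨z, w⟩, hz⟩ := ι.surjective (J (ι (1, 0)))
  -- Otherwise J1 = x1 with x real, and J² = -1 would give x² = -1.
  have hne : (⟨0, z.im⟩, w) ≠ (0 : ℂ × ℂ) := by
    intro h
    have hzi : z.im = 0 := congrArg (fun x => (Prod.fst x).im) h
    have hw : w = 0 := congrArg Prod.snd h
    have h1 : ((z, w) : ℂ × ℂ) = z.re • ((1 : ℂ), (0 : ℂ)) := by
      rw [hw]
      ext1 <;> apply Complex.ext <;> simp [hzi]
    have h2 := hJ.sq (ι (1, 0))
    rw [← hz, h1, map_smul, map_smul, ← hz, h1, ← map_smul, ← map_neg] at h2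
    have h3 := congrArg (fun x => (Prod.fst x).re) (ι.injective h2)
    simp at h3
    nlinarith [mul_self_nonneg z.re]
  obtain ⟨v, hv, b, hb, hvb⟩ := exists_qAd_eq z.im w hne
  have h1 : J (((qAd v hv).trans ι) (1, 0)) = ((qAd v hv).trans ι) (⟨z.re, b⟩, 0) := by
    rw [LinearEquiv.trans_apply, LinearEquiv.trans_apply, qAd_one, ← hz]
    congr 1
    have h2 : ((⟨z.re, b⟩, 0) : ℂ × ℂ) = z.re • ((1 : ℂ), (0 : ℂ)) + (⟨0, b⟩, 0) := by
      ext1 <;> apply Complex.ext <;> simp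
    rw [h2, map_add, map_smul, qAd_one, hvb]
    ext1 <;> apply Complex.ext <;> simp
  rcases hJ.apply_snd (hι.qAd v hv) hb h1 with h | h
  · exact ⟨v, hv, z.re, b, hb, h1, h⟩
  -- Conjugation by j sends i to -i and (0, w) to (0, w̄). Composing with it replaces b by -b and
  -- turns multiplication by -i into multiplication by i.
  · have hj : qnorm ((0 : ℂ), (1 : ℂ)) = 1 := by simp [qnorm]
    have hvj : qnorm (qmul v (0, 1)) = 1 := by rw [qnorm_qmul, hv, hj, one_mul]
    refine ⟨qmul v (0, 1), hvj, z.re, -b, neg_ne_zero.2 hb, ?_, fun x => ?_⟩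
    · rw [qAd_one, qAd_comp v (0, 1) hv hj]
      have e : qAd (0, 1) hj (⟨z.re, -b⟩, 0) = (⟨z.re, b⟩, 0) := by
        ext1 <;> apply Complex.ext <;> simp [qAd_apply, qmul, qconj]
      rw [e]
      have := h1
      simp only [LinearEquiv.trans_apply, qAd_one] at this
      exact this
    · have e (y : ℂ) : qAd (0, 1) hj (0, y) = (0, (starRingEnd ℂ) y) := by
        ext1 <;> simp [qAd_apply, qmul, qconj]
      rw [qAd_comp v (0, 1) hv hj, qAd_comp v (0, 1) hv hj, e, e]
      have := h ((starRingEnd ℂ) x)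
      simp only [LinearEquiv.trans_apply] at this
      rw [this]
      simp

end NormalForm

/-! ### The Levi-Civita connection and a criterion for Vaisman type -/

section VaismanCriterion

variable {L : Type*} [LieRing L] [LieAlgebra ℝ L]

lemma nondegenerate_of_pos {h : LinearMap.BilinForm ℝ L} (hpos : ∀ U, U ≠ 0 → 0 < h U U) :
    h.Nondegenerate := by
  constructor <;> intro U hU <;> by_contra hne <;> exact (hpos U hne).ne' (hU U)

/-- A metric on a finite-dimensional Lie algebra has a Levi-Civita connection. -/
lemma exists_isLeviCivita [FiniteDimensional ℝ L] (h : LinearMap.BilinForm ℝ L)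
    (hsymm : ∀ U V, h U V = h V U) (hpos : ∀ U, U ≠ 0 → 0 < h U U) :
    ∃ D : L →ₗ[ℝ] L →ₗ[ℝ] L, IsLeviCivita h D ∧
      ∀ U V Z, 2 * h (D U V) Z = h ⁅U, V⁆ Z - h U ⁅V, Z⁆ - h V ⁅U, Z⁆ := by
  have hnd : h.Nondegenerate := nondegenerate_of_pos hpos
  -- The Koszul formula: its derivative terms vanish, since h is constant on left-invariant fields.
  let ℓ (U V : L) : Module.Dual ℝ L := (2⁻¹ : ℝ) •
    (h ⁅U, V⁆ - h U ∘ₗ (LieAlgebra.ad ℝ L V) - h V ∘ₗ (LieAlgebra.ad ℝ L U))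
  let D : L →ₗ[ℝ] L →ₗ[ℝ] L := LinearMap.mk₂ ℝ (fun U V => (h.toDual hnd).symm (ℓ U V))
    (fun U U' V => by rw [← map_add]; congr 1; ext Z; simp [ℓ]; ring)
    (fun c U V => by rw [← map_smul]; congr 1; ext Z; simp [ℓ]; ring)
    (fun U V V' => by rw [← map_add]; congr 1; ext Z; simp [ℓ]; ring)
    (fun c U V => by rw [← map_smul]; congr 1; ext Z; simp [ℓ]; ring)
  have hD (U V Z : L) : 2 * h (D U V) Z = h ⁅U, V⁆ Z - h U ⁅V, Z⁆ - h V ⁅U, Z⁆ := by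
    have : h (D U V) Z = ℓ U V Z :=
      LinearMap.BilinForm.apply_toDual_symm_apply (hB := hnd) _ _
    rw [this]
    simp [ℓ]
  refine ⟨D, ⟨fun U V => ?_, fun U V Z => ?_⟩, hD⟩
  · by_contra hne
    have h1 := hpos _ (sub_ne_zero.2 hne)
    set X := D U V - D V U - ⁅U, V⁆ with hX
    have h2 (Z) : 2 * h X Z = 0 := by
      rw [hX, map_sub, map_sub, LinearMap.sub_apply, LinearMap.sub_apply, mul_sub,
        mul_sub, hD, hD, ← lie_skew U V, map_neg, LinearMap.neg_apply]
      ring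
    linarith [h2 X]
  · have h1 := hD U V Z
    have h2 := hD U Z V
    rw [hsymm V, ← lie_skew Z V, map_neg] at *
    rw [hsymm ⁅U, V⁆, hsymm ⁅U, Z⁆] at *
    linarith

lemma IsLCK.metric_symm {J : L →ₗ[ℝ] L} (hsq : ∀ U, J (J U) = -U) {Ω : LinearMap.BilinForm ℝ L}
    {θ : Module.Dual ℝ L} (hΩ : IsLCK J Ω θ) (U V : L) : metric J Ω U V = metric J Ω V U := by
  change Ω (J U) V = Ω (J V) U
  rw [← hΩ.invariant, hsq, map_neg, LinearMap.neg_apply, hΩ.alt.neg_eq]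

/-- A locally conformally Kähler structure is of Vaisman type when its Lee field is a Killing
field. -/
lemma IsLCK.isVaisman_of_killing [FiniteDimensional ℝ L] {J : L →ₗ[ℝ] L}
    (hsq : ∀ U, J (J U) = -U) {Ω : LinearMap.BilinForm ℝ L}
    {θ : Module.Dual ℝ L} (hΩ : IsLCK J Ω θ) {ξ : L} (hξ : IsDualField (metric J Ω) θ ξ)
    (hK : ∀ U V, metric J Ω ⁅ξ, U⁆ V + metric J Ω U ⁅ξ, V⁆ = 0) : IsVaisman J Ω θ := by
  obtain ⟨D, hD, hD'⟩ := exists_isLeviCivita (metric J Ω) (hΩ.metric_symm hsq) hΩ.pos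
  refine ⟨ξ, D, hξ, hD, fun U => ?_⟩
  by_contra hne
  have h1 := hΩ.pos _ hne
  -- In the Koszul formula for ∇_U ξ, closedness of θ kills the term h(ξ, [U, Z]), and the Killing
  -- equation cancels the other two. The choice Z = ∇_U ξ makes its square norm vanish.
  have h2 := hD' U ξ (D U ξ)
  have h3 := hK U (D U ξ)
  have h4 := hΩ.lee_closed U (D U ξ)
  rw [d₁, ← hξ, neg_eq_zero] at h4
  rw [h4, ← lie_skew, map_neg, LinearMap.neg_apply] at h2
  linarith

end VaismanCriterion

/-! ### The lcK structures in normal form -/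

section Quaternionic

variable {L : Type*} [LieRing L] [LieAlgebra ℝ L]

/-- The value of J at i is forced: apply J to J1 = a + bi, use J² = -1 and divide by b. -/
lemma IsComplexStructure.apply_normalForm {ι : (ℂ × ℂ) ≃ₗ[ℝ] L} {J : L →ₗ[ℝ] L}
    (hJ : IsComplexStructure J) {a b : ℝ} (hb : b ≠ 0)
    (h1 : J (ι (1, 0)) = ι (⟨a, b⟩, 0)) (h2 : ∀ w, J (ι (0, w)) = ι (0, Complex.I * w))
    (z : ℂ × ℂ) : J (ι z) = ι (⟨a * z.1.re - (1 + a ^ 2) / b * z.1.im, b * z.1.re - a * z.1.im⟩,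
      Complex.I * z.2) := by
  have hi : J (ι (Complex.I, 0)) = ι (⟨-(1 + a ^ 2) / b, -a⟩, 0) := by
    have h := hJ.sq (ι (1, 0))
    have e : ((⟨a, b⟩, 0) : ℂ × ℂ) = a • ((1 : ℂ), (0 : ℂ)) + b • (Complex.I, (0 : ℂ)) := by
      ext1 <;> apply Complex.ext <;> simp
    rw [h1, e, map_add, map_add, map_smul, map_smul, map_smul, map_smul, h1] at h
    have h3 : b • J (ι (Complex.I, 0)) = ι (-((1 : ℂ), (0 : ℂ)) - a • (⟨a, b⟩, 0)) := by
      rw [map_sub, map_neg, map_smul, ← h]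
      abel
    rw [← smul_right_injective L hb |>.eq_iff]
    simp only [h3, ← map_smul]
    congr 1
    ext1 <;> apply Complex.ext <;> simp
    · field_simp
      ring
    · ring
  have e : z = z.1.re • ((1 : ℂ), (0 : ℂ)) + z.1.im • (Complex.I, (0 : ℂ)) + (0, z.2) := by
    ext1 <;> apply Complex.ext <;> simp
  conv_lhs => rw [e]
  rw [map_add, map_add, map_add, map_add, map_smul, map_smul, map_smul, map_smul, h1, h2, hi,
    ← map_smul, ← map_smul, ← map_add, ← map_add]
  congr 1
  ext1 <;> apply Complex.ext <;> simp <;> ring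

/-- The form `-θ ∧ φ + dφ`. -/
def reebForm (θ φ : Module.Dual ℝ L) : LinearMap.BilinForm ℝ L :=
  LinearMap.mk₂ ℝ (fun U V => -wedge₁₁ θ φ U V + d₁ φ U V)
    (fun U U' V => by simp [wedge₁₁, d₁]; ring)
    (fun c U V => by simp [wedge₁₁, d₁]; ring)
    (fun U V V' => by simp [wedge₁₁, d₁]; ring)
    (fun c U V => by simp [wedge₁₁, d₁]; ring)

lemma reebForm_apply (θ φ : Module.Dual ℝ L) (U V : L) :
    reebForm θ φ U V = -wedge₁₁ θ φ U V + d₁ φ U V := rfl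

/-- If `dθ = 0`, then `d(-θ ∧ φ + dφ) = θ ∧ (-θ ∧ φ + dφ)`. -/
lemma d₂_reebForm (θ φ : Module.Dual ℝ L) (hθ : ∀ U V, d₁ θ U V = 0) (U V Z : L) :
    d₂ (reebForm θ φ) U V Z = wedge₁₂ θ (reebForm θ φ) U V Z := by
  have h (U V) : θ ⁅U, V⁆ = 0 := neg_eq_zero.1 (hθ U V)
  -- The Jacobi identity, which is d(dφ) = 0.
  have hj : φ ⁅⁅U, V⁆, Z⁆ = φ ⁅⁅U, Z⁆, V⁆ - φ ⁅⁅V, Z⁆, U⁆ := by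
    rw [← map_sub]
    congr 1
    rw [lie_lie, ← lie_skew ⁅U, Z⁆ V, ← lie_skew ⁅V, Z⁆ U]
    abel
  simp only [d₂, wedge₁₂, reebForm_apply, wedge₁₁, d₁, h, hj]
  ring

/-- The pair θ, φ satisfies θ∘J = -φ and φ∘J = θ, so θ ∧ φ is J-invariant and contributes θ² + φ² to
the metric. The form dφ is an area form on span(j, k), where J is multiplication by i. -/
lemma exists_lck_of_normalForm {ι : (ℂ × ℂ) ≃ₗ[ℝ] L} (hι : IsQuaternionic ι) {J : L →ₗ[ℝ] L}
    (hJ : IsComplexStructure J) {a b : ℝ} (hb : b ≠ 0)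
    (h1 : J (ι (1, 0)) = ι (⟨a, b⟩, 0)) (h2 : ∀ w, J (ι (0, w)) = ι (0, Complex.I * w)) :
    ∃ (Ω : LinearMap.BilinForm ℝ L) (θ φ : Module.Dual ℝ L) (ξ : L),
      IsLCK J Ω θ ∧ IsDualField (metric J Ω) θ ξ ∧ metric J Ω ξ ξ = 1 ∧
      IsDualField (metric J Ω) φ (J ξ) ∧
      ∀ U V, Ω U V = -wedge₁₁ θ φ U V + d₁ φ U V := by
  have hJι := hJ.apply_normalForm hb h1 h2
  have ha : 0 < 1 + a ^ 2 := by positivity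
  -- For θ = c Re, the form dφ contributes -2c(1 + a²)/b times the Euclidean metric of span(j, k).
  -- Any c of sign opposite to b gives a positive metric; c = -b removes the denominator.
  let θ : Module.Dual ℝ L := (-b) • Complex.reLm ∘ₗ LinearMap.fst ℝ ℂ ℂ ∘ₗ ι.symm.toLinearMap
  let φ : Module.Dual ℝ L := -(θ ∘ₗ J)
  have hθ (z) : θ (ι z) = -b * z.1.re := by simp [θ]
  have hφ (z) : φ (ι z) = a * b * z.1.re - (1 + a ^ 2) * z.1.im := by
    simp only [φ, LinearMap.neg_apply, LinearMap.comp_apply, hJι, hθ]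
    field_simp
  have hd (z w) : d₁ φ (ι z) (ι w) = 2 * (1 + a ^ 2) * (z.2.im * w.2.re - z.2.re * w.2.im) := by
    rw [d₁, hι, hφ]
    simp [qmul]
    ring
  have hθφ (U) : θ (J U) = -φ U := by simp [φ]
  have hφθ (U) : φ (J U) = θ U := by simp [φ, hJ.sq]
  have hΩ := reebForm_apply θ φ
  have hdι (z w) : reebForm θ φ (J (ι z)) (ι w) = θ (ι z) * θ (ι w) + φ (ι z) * φ (ι w) +
      2 * (1 + a ^ 2) * (z.2.re * w.2.re + z.2.im * w.2.im) := by
    rw [hΩ, wedge₁₁, hθφ, hφθ, hJι, hd]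
    simp
    ring
  -- The Lee field is the vector of span(1, i) with θ = 1 and φ = 0.
  have hξ : θ (ι (⟨-b⁻¹, -a / (1 + a ^ 2)⟩, 0)) = 1 := by rw [hθ]; field_simp
  have hξ' : φ (ι (⟨-b⁻¹, -a / (1 + a ^ 2)⟩, 0)) = 0 := by rw [hφ]; field_simp; ring
  have hdual : IsDualField (metric J (reebForm θ φ)) θ (ι (⟨-b⁻¹, -a / (1 + a ^ 2)⟩, 0)) := by
    intro U
    obtain ⟨w, rfl⟩ := ι.surjective U
    refine (hdι _ _).trans ?_
    rw [hξ, hξ']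
    simp
  have hclosed (U V) : d₁ θ U V = 0 := by
    obtain ⟨z, rfl⟩ := ι.surjective U
    obtain ⟨w, rfl⟩ := ι.surjective V
    rw [d₁, hι, hθ]
    simp [qmul]
    right
    ring
  have hinv (U V) : reebForm θ φ (J U) (J V) = reebForm θ φ U V := by
    obtain ⟨z, rfl⟩ := ι.surjective U
    obtain ⟨w, rfl⟩ := ι.surjective V
    rw [hΩ, hΩ, wedge₁₁, wedge₁₁, hθφ, hφθ, hθφ, hφθ, hJι, hJι, hd, hd]
    simp
    ring
  refine ⟨reebForm θ φ, θ, φ, _, ⟨fun U => ?_, hinv, fun U hU => ?_, hclosed,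
    d₂_reebForm θ φ hclosed⟩, hdual, (hdual _).trans hξ, fun U => ?_, hΩ⟩
  · rw [hΩ, d₁, lie_self, wedge₁₁]
    simp
  · obtain ⟨z, rfl⟩ := ι.surjective U
    change 0 < reebForm θ φ (J (ι z)) (ι z)
    rw [hdι, hθ, hφ]
    have hz : z ≠ 0 := by rintro rfl; exact hU (map_zero ι)
    by_contra hle
    have h0 : (-b * z.1.re) * (-b * z.1.re) + (a * b * z.1.re - (1 + a ^ 2) * z.1.im) *
        (a * b * z.1.re - (1 + a ^ 2) * z.1.im) +
        2 * (1 + a ^ 2) * (z.2.re * z.2.re + z.2.im * z.2.im) ≤ 0 := not_lt.1 hle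
    have n1 := mul_self_nonneg (-b * z.1.re)
    have n2 := mul_self_nonneg (a * b * z.1.re - (1 + a ^ 2) * z.1.im)
    have n3 : 0 ≤ z.2.re * z.2.re + z.2.im * z.2.im := by
      nlinarith [mul_self_nonneg z.2.re, mul_self_nonneg z.2.im]
    have n4 : 0 ≤ 2 * (1 + a ^ 2) * (z.2.re * z.2.re + z.2.im * z.2.im) := by positivity
    have e1 : -b * z.1.re = 0 := mul_self_eq_zero.1 (by linarith)
    have e2 : a * b * z.1.re - (1 + a ^ 2) * z.1.im = 0 := mul_self_eq_zero.1 (by linarith)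
    have e3 : 2 * (1 + a ^ 2) * (z.2.re * z.2.re + z.2.im * z.2.im) = 0 := by linarith
    have r1 : z.1.re = 0 := by simpa [hb] using e1
    have r2 : z.1.im = 0 := by
      rw [r1] at e2
      simpa [ha.ne'] using e2
    have e4 : z.2.re * z.2.re + z.2.im * z.2.im = 0 := by simpa [ha.ne'] using e3
    have r3 : z.2 = 0 := Complex.normSq_eq_zero.1 (by rw [Complex.normSq_apply, e4])
    exact hz (Prod.ext (Complex.ext r1 r2) r3)
  · have h := hdual (J U)
    rw [hθφ] at h
    change reebForm θ φ (J (J _)) U = φ U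
    rw [← neg_eq_iff_eq_neg.2 h]
    change _ = -(reebForm θ φ (J _) (J U))
    rw [hinv, hJ.sq]
    simp

/-! ### Every compatible lcK structure is of Vaisman type -/

lemma IsLCK.isVaisman_of_normalForm {ι : (ℂ × ℂ) ≃ₗ[ℝ] L} (hι : IsQuaternionic ι)
    {J : L →ₗ[ℝ] L} (hJ : IsComplexStructure J) {a b : ℝ}
    (h1 : J (ι (1, 0)) = ι (⟨a, b⟩, 0)) (h2 : ∀ w, J (ι (0, w)) = ι (0, Complex.I * w))
    {Ω : LinearMap.BilinForm ℝ L} {θ : Module.Dual ℝ L} (hΩ : IsLCK J Ω θ) : IsVaisman J Ω θ := by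
  have : FiniteDimensional ℝ L := ι.finiteDimensional
  set e₀ := ι (1, 0) with he₀
  set e₁ := ι (Complex.I, 0) with he₁
  set e₂ := ι (0, 1) with he₂
  set e₃ := ι (0, Complex.I) with he₃
  have hexp (U : L) : ∃ u₀ u₁ u₂ u₃ : ℝ, U = u₀ • e₀ + u₁ • e₁ + u₂ • e₂ + u₃ • e₃ := by
    obtain ⟨z, rfl⟩ := ι.surjective U
    refine ⟨z.1.re, z.1.im, z.2.re, z.2.im, ?_⟩
    rw [he₀, he₁, he₂, he₃, ← map_smul, ← map_smul, ← map_smul, ← map_smul, ← map_add, ← map_add,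
      ← map_add]
    congr 1
    ext1 <;> apply Complex.ext <;> simp
  have b0 (U : L) : ⁅e₀, U⁆ = 0 := by
    obtain ⟨z, rfl⟩ := ι.surjective U
    rw [he₀, hι, one_qmul, qmul_one, sub_self, map_zero]
  have b0' (U : L) : ⁅U, e₀⁆ = 0 := by rw [← lie_skew, b0, neg_zero]
  have b12 : ⁅e₁, e₂⁆ = -(2 : ℝ) • e₃ := by
    rw [he₁, he₂, he₃, hι, ← map_smul]
    congr 1
    ext1 <;> apply Complex.ext <;> simp [qmul]; norm_num
  have b23 : ⁅e₂, e₃⁆ = -(2 : ℝ) • e₁ := by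
    rw [he₁, he₂, he₃, hι, ← map_smul]
    congr 1
    ext1 <;> apply Complex.ext <;> simp [qmul]; norm_num
  have b31 : ⁅e₃, e₁⁆ = -(2 : ℝ) • e₂ := by
    rw [he₁, he₂, he₃, hι, ← map_smul]
    congr 1
    ext1 <;> apply Complex.ext <;> simp [qmul]; norm_num
  have b13 : ⁅e₁, e₃⁆ = (2 : ℝ) • e₂ := by rw [← lie_skew, b31, neg_smul, neg_neg]
  have j0 : J e₀ = a • e₀ + b • e₁ := by
    rw [he₀, he₁, h1, ← map_smul, ← map_smul, ← map_add]
    congr 1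
    ext1 <;> apply Complex.ext <;> simp
  have j2 : J e₂ = e₃ := by rw [he₂, h2, mul_one]
  have j3 : J e₃ = -e₂ := by rw [← j2, hJ.sq]
  have ne0 : e₀ ≠ 0 := by rw [he₀]; simp
  have ne2 : e₂ ≠ 0 := by rw [he₂]; simp
  have t1 : θ e₁ = 0 := by
    have h := hΩ.lee_closed e₂ e₃
    rw [d₁, b23, map_smul] at h
    simpa using h
  have t2 : θ e₂ = 0 := by
    have h := hΩ.lee_closed e₃ e₁
    rw [d₁, b31, map_smul] at h
    simpa using h
  have t3 : θ e₃ = 0 := by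
    have h := hΩ.lee_closed e₁ e₂
    rw [d₁, b12, map_smul] at h
    simpa using h
  have sw (U V : L) : Ω U V = -Ω V U := (hΩ.alt.neg_eq V U).symm
  -- As e₀ is central and θ vanishes on e₁, e₂, e₃, each equation relates one value Ω(e₀, eᵢ) to one
  -- value Ω(eⱼ, eₖ).
  have d23 := hΩ.lck e₀ e₂ e₃
  have d12 := hΩ.lck e₀ e₁ e₂
  have d31 := hΩ.lck e₀ e₃ e₁
  simp only [d₂, wedge₁₂, b0, b23, b12, b31, t1, t2, t3, map_zero, LinearMap.zero_apply, neg_zero,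
    zero_mul, sub_zero, add_zero, map_smul, LinearMap.smul_apply, smul_eq_mul]
    at d23 d12 d31
  have i2 := hΩ.invariant e₀ e₂
  have i3 := hΩ.invariant e₀ e₃
  simp only [j0, j2, j3, map_add, map_neg, map_smul, LinearMap.add_apply, LinearMap.smul_apply,
    smul_eq_mul] at i2 i3
  have p0 : 0 < Ω (J e₀) e₀ := hΩ.pos e₀ ne0
  have p2 : 0 < Ω (J e₂) e₂ := hΩ.pos e₂ ne2
  simp only [j0, j2, map_add, map_smul, LinearMap.add_apply, LinearMap.smul_apply, smul_eq_mul,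
    hΩ.alt.self_eq_zero] at p0 p2
  set s := θ e₀ with hs
  rw [sw e₃ e₂] at p2
  rw [sw e₃ e₀] at d12
  rw [sw e₂ e₀, sw e₃ e₁] at d31
  -- Positivity of h at e₀ and e₂ gives b Ω(e₁, e₀) > 0 and Ω(e₂, e₃) < 0, while `d23` reads 2 Ω(e₁,
  -- e₀) = s Ω(e₂, e₃).
  have hbs : b * s < 0 := by
    by_contra hle
    have e : b * s * -Ω e₂ e₃ = -(2 * (b * Ω e₁ e₀)) := by linear_combination b * d23
    linarith [mul_nonneg (not_lt.1 hle) p2.le]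
  -- The combination of `i2` and `i3` with coefficients Ω(e₀, e₂) and Ω(e₀, e₃) eliminates a; then
  -- `d31` and `d12` eliminate Ω(e₁, e₃) and Ω(e₁, e₂). The first factor is nonzero, since s = 2b
  -- would give bs ≥ 0.
  have hsum : (s - 2 * b) * (Ω e₀ e₂ ^ 2 + Ω e₀ e₃ ^ 2) = 0 := by
    linear_combination (-s * Ω e₀ e₂) * i2 - s * Ω e₀ e₃ * i3 +
      b * Ω e₀ e₂ * d31 + b * Ω e₀ e₃ * d12
  have hne : s - 2 * b ≠ 0 := by
    intro h0
    have : s = 2 * b := by linarith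
    rw [this] at hbs
    nlinarith [mul_self_nonneg b]
  have hs0 : s ≠ 0 := by rintro h0; rw [h0] at hbs; simp at hbs
  have hsum' := (mul_eq_zero.1 hsum).resolve_left hne
  have o02 : Ω e₀ e₂ = 0 := by nlinarith [sq_nonneg (Ω e₀ e₂), sq_nonneg (Ω e₀ e₃)]
  have o03 : Ω e₀ e₃ = 0 := by nlinarith [sq_nonneg (Ω e₀ e₂), sq_nonneg (Ω e₀ e₃)]
  have o12 : Ω e₁ e₂ = 0 := by
    rw [o03] at d12
    simpa [hs0] using d12
  have o13 : Ω e₁ e₃ = 0 := by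
    rw [o02] at d31
    simpa [hs0] using d31
  have hsymm := hΩ.metric_symm hJ.sq
  set h := metric J Ω with hh
  have hap (U V : L) : h U V = Ω (J U) V := rfl
  have m2 (u₀ u₁ u₂ u₃ : ℝ) : h e₂ (u₀ • e₀ + u₁ • e₁ + u₂ • e₂ + u₃ • e₃) = u₂ * -Ω e₂ e₃ := by
    simp only [hap, j2, map_add, map_smul, smul_eq_mul, hΩ.alt.self_eq_zero]
    rw [sw e₃ e₀, sw e₃ e₁, sw e₃ e₂, o03, o13]
    ring
  have m3 (u₀ u₁ u₂ u₃ : ℝ) : h e₃ (u₀ • e₀ + u₁ • e₁ + u₂ • e₂ + u₃ • e₃) = u₃ * -Ω e₂ e₃ := by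
    simp only [hap, j3, map_neg, LinearMap.neg_apply, map_add, map_smul, smul_eq_mul,
      hΩ.alt.self_eq_zero]
    rw [sw e₂ e₀, sw e₂ e₁, o02, o12]
    ring
  obtain ⟨ξ, hξ⟩ : ∃ ξ, IsDualField h θ ξ := by
    have hnd : h.Nondegenerate := nondegenerate_of_pos hΩ.pos
    exact ⟨(h.toDual hnd).symm θ,
      fun U => LinearMap.BilinForm.apply_toDual_symm_apply (hB := hnd) _ _⟩
  obtain ⟨x₀, x₁, x₂, x₃, hx⟩ := hexp ξ
  have hx2 : x₂ = 0 := by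
    have h := hξ e₂
    rw [hsymm, hx, m2, t2] at h
    exact (mul_eq_zero.1 h).resolve_right p2.ne'
  have hx3 : x₃ = 0 := by
    have h := hξ e₃
    rw [hsymm, hx, m3, t3] at h
    exact (mul_eq_zero.1 h).resolve_right p2.ne'
  refine hΩ.isVaisman_of_killing hJ.sq hξ fun U V => ?_
  rw [hx2, hx3] at hx
  -- So ad ξ kills e₀, e₁ and is skew on span(e₂, e₃), where by `m2` and `m3` the metric is a
  -- multiple of the Euclidean one: ξ is Killing.
  have hbr (u₀ u₁ u₂ u₃ : ℝ) : ⁅ξ, u₀ • e₀ + u₁ • e₁ + u₂ • e₂ + u₃ • e₃⁆ =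
      (2 * x₁ * u₃) • e₂ - (2 * x₁ * u₂) • e₃ := by
    simp only [hx, zero_smul, add_zero, add_lie, smul_lie, b0, smul_zero, zero_add, lie_add,
      lie_smul, b0', lie_self, b12, b13, smul_smul]
    rw [add_comm, sub_eq_add_neg, ← neg_smul]
    congr 2 <;> ring
  obtain ⟨u₀, u₁, u₂, u₃, rfl⟩ := hexp U
  obtain ⟨v₀, v₁, v₂, v₃, rfl⟩ := hexp V
  change h ⁅ξ, _⁆ _ + h _ ⁅ξ, _⁆ = 0
  rw [hsymm _ ⁅ξ, _⁆, hbr, hbr]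
  simp only [map_sub, map_smul, LinearMap.sub_apply, LinearMap.smul_apply, smul_eq_mul, m2, m3]
  ring

end Quaternionic

/-! ### Polar coordinates: `S¹ × SU(2)` and `ℂ² ∖ {0}` -/

/-- The first column of a matrix in `SU(2)`. -/
def col (A : SU2) : ℂ × ℂ := (A.1 0 0, A.1 1 0)

lemma qnorm_col (A : SU2) : qnorm (col A) = 1 := by
  have h := (mem_S3_iff _).1 (su2_mem_S3 A)
  apply Complex.ofReal_injective
  rw [qnorm, Complex.ofReal_add, ← Complex.mul_conj, ← Complex.mul_conj, Complex.ofReal_one]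
  exact h

lemma col_mul (A B : SU2) : col (A * B) = qmul (col A) (col B) := by
  have h := su2_entries A
  ext1 <;> simp [col, qmul, Matrix.mul_apply, Fin.sum_univ_two, h.1, h.2]
  ring

lemma col_injective : Function.Injective col := fun A B h => by
  have h0 : A.1 0 0 = B.1 0 0 := congrArg Prod.fst h
  have h1 : A.1 1 0 = B.1 1 0 := congrArg Prod.snd h
  apply Subtype.ext
  ext i j
  fin_cases i <;> fin_cases j <;> simp [h0, h1, su2_entries A, su2_entries B]

lemma exists_col_eq {z : ℂ × ℂ} (hz : qnorm z = 1) : ∃ A : SU2, col A = z := by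
  have hm : (WithLp.toLp 2 z : WithLp 2 (ℂ × ℂ)) ∈ Metric.sphere (0 : WithLp 2 (ℂ × ℂ)) 1 := by
    rw [mem_S3_iff, Complex.mul_conj, Complex.mul_conj]
    exact_mod_cast hz
  exact ⟨⟨_, su2Matrix_mem ⟨_, hm⟩⟩, rfl⟩

open Classical in
/-- The matrix in `SU(2)` with a given unit vector as its first column. -/
def toSU2 (z : ℂ × ℂ) : SU2 := if h : qnorm z = 1 then (exists_col_eq h).choose else 1

lemma col_toSU2 {z : ℂ × ℂ} (hz : qnorm z = 1) : col (toSU2 z) = z := by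
  rw [toSU2, dif_pos hz]
  exact (exists_col_eq hz).choose_spec

lemma toSU2_col (A : SU2) : toSU2 (col A) = A := col_injective (col_toSU2 (qnorm_col A))

lemma normSq_exp (z : ℂ) : Complex.normSq (Complex.exp z) = Real.exp (2 * z.re) := by
  rw [Complex.normSq_eq_norm_sq, Complex.norm_exp, ← Real.exp_nat_mul]
  norm_num

/-- The time at which the spiral `t ↦ exp (κ t) y` through `z`, with `y` of norm `1`, reaches
`z`. -/
def spiralTime (κ : ℂ) (z : ℂ × ℂ) : ℝ := Real.log (qnorm z) / (2 * κ.re)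

/-- The inverse of `(exp (i t), A) ↦ exp (κ t) A v`. -/
def polar (κ : ℂ) (v z : ℂ × ℂ) : G :=
  (Circle.exp (spiralTime κ z),
    toSU2 (qmul (Complex.exp (-(κ * spiralTime κ z)) • z) (qconj v)))

/-- The map `(exp (i s), A) ↦ exp (κ s) A v`, for the branch of `s` centred at `t`. -/
def spiral (κ : ℂ) (v : ℂ × ℂ) (t : ℝ) (p : G) : ℂ × ℂ :=
  Complex.exp (κ * ((t + Complex.arg (p.1 * Circle.exp (-t) : Circle) : ℝ) : ℂ)) •
    qmul (col p.2) v

section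

variable {κ : ℂ} {v : ℂ × ℂ}

lemma spiralTime_exp (hκ : κ.re ≠ 0) (hv : qnorm v = 1) (s : ℝ) (A : SU2) :
    spiralTime κ (Complex.exp (κ * s) • qmul (col A) v) = s := by
  rw [spiralTime, qnorm_smul, qnorm_qmul, qnorm_col, hv, normSq_exp, mul_one, mul_one,
    Real.log_exp, Complex.re_mul_ofReal]
  field_simp

lemma polar_exp (hκ : κ.re ≠ 0) (hv : qnorm v = 1) (s : ℝ) (A : SU2) :
    polar κ v (Complex.exp (κ * s) • qmul (col A) v) = (Circle.exp s, A) := by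
  rw [polar, spiralTime_exp hκ hv, smul_smul, ← Complex.exp_add, neg_add_cancel, Complex.exp_zero,
    one_smul, qmul_assoc, qmul_qconj, hv, Complex.ofReal_one, qmul_one, toSU2_col]

lemma polar_spiral (hκ : κ.re ≠ 0) (hv : qnorm v = 1) (t : ℝ) (p : G) : polar κ v (spiral κ v t p) = p := by
  rw [spiral, polar_exp hκ hv, Circle.exp_add, Circle.exp_arg, Circle.exp_neg]
  ext1
  · simp
  · rfl

lemma qnorm_unit (hκ : κ.re ≠ 0) (hv : qnorm v = 1) {z : ℂ × ℂ}
    (hz : z ≠ 0) :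
    qnorm (qmul (Complex.exp (-(κ * spiralTime κ z)) • z) (qconj v)) = 1 := by
  rw [qnorm_qmul, qnorm_qconj, hv, mul_one, qnorm_smul, normSq_exp, Complex.neg_re,
    Complex.re_mul_ofReal, spiralTime]
  have h : 2 * -(κ.re * (Real.log (qnorm z) / (2 * κ.re))) = -Real.log (qnorm z) := by
    field_simp
  rw [h, Real.exp_neg, Real.exp_log (qnorm_pos hz), inv_mul_cancel₀ (qnorm_pos hz).ne']

lemma col_polar (hκ : κ.re ≠ 0) (hv : qnorm v = 1) {z : ℂ × ℂ}
    (hz : z ≠ 0) :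
    col (polar κ v z).2 = qmul (Complex.exp (-(κ * spiralTime κ z)) • z) (qconj v) :=
  col_toSU2 (qnorm_unit hκ hv hz)

lemma exp_smul_polar (hκ : κ.re ≠ 0) (hv : qnorm v = 1) {z : ℂ × ℂ}
    (hz : z ≠ 0) :
    Complex.exp (κ * spiralTime κ z) • qmul (col (polar κ v z).2) v = z := by
  rw [col_polar hκ hv hz, qmul_assoc, qconj_qmul, hv, Complex.ofReal_one, qmul_one, smul_smul,
    ← Complex.exp_add, add_neg_cancel, Complex.exp_zero, one_smul]

lemma spiral_ne_zero (hv : qnorm v = 1) (t : ℝ) (p : G) : spiral κ v t p ≠ 0 := by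
  apply ne_zero_of_qnorm_pos
  rw [spiral, qnorm_smul, qnorm_qmul, qnorm_col, hv, normSq_exp]
  positivity

end

/-! ### Smoothness -/

instance : IsManifold 𝓘(ℝ, ℂ × ℂ) ω W := isOpenEmbedding_W.isManifold_singleton

lemma contMDiff_W_val : ContMDiff 𝓘(ℝ, ℂ × ℂ) 𝓘(ℝ, ℂ × ℂ) ω (Subtype.val : W → ℂ × ℂ) :=
  contMDiff_isOpenEmbedding isOpenEmbedding_W

/-- A map on `ℂ²` is smooth away from `0` if its restriction to `W` is. -/
lemma contMDiffAt_of_W {E H M : Type*} [NormedAddCommGroup E] [NormedSpace ℝ E]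
    [TopologicalSpace H] {I : ModelWithCorners ℝ E H} [TopologicalSpace M] [ChartedSpace H M]
    {f : ℂ × ℂ → M} {n : WithTop ℕ∞} (hf : ContMDiff 𝓘(ℝ, ℂ × ℂ) I n fun w : W => f w.1)
    {z : ℂ × ℂ} (hz : z ≠ 0) : ContMDiffAt 𝓘(ℝ, ℂ × ℂ) I n f z := by
  have hr : Set.range (Subtype.val : W → ℂ × ℂ) ∈ nhds z :=
    isOpenEmbedding_W.isOpen_range.mem_nhds ⟨⟨z, hz⟩, rfl⟩
  have h1 := (contMDiffOn_isOpenEmbedding_symm (I := 𝓘(ℝ, ℂ × ℂ)) (n := n)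
    isOpenEmbedding_W).contMDiffAt hr
  refine (hf.contMDiffAt.comp z h1).congr_of_eventuallyEq ?_
  filter_upwards [hr] with y hy
  have := (isOpenEmbedding_W.toOpenPartialHomeomorph _).right_inv (x := y) (by simpa using hy)
  exact congrArg f this.symm

lemma contDiff_qnorm : ContDiff ℝ ω qnorm := by
  have h : qnorm = fun z : ℂ × ℂ => Complex.reCLM z.1 * Complex.reCLM z.1 +
      Complex.imCLM z.1 * Complex.imCLM z.1 + (Complex.reCLM z.2 * Complex.reCLM z.2 +
      Complex.imCLM z.2 * Complex.imCLM z.2) := by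
    ext z
    simp [qnorm, Complex.normSq_apply]
  rw [h]
  fun_prop

lemma contDiffAt_spiralTime (κ : ℂ) {z : ℂ × ℂ} (hz : z ≠ 0) :
    ContDiffAt ℝ ω (spiralTime κ) z :=
  (contDiff_qnorm.contDiffAt.log (qnorm_pos hz).ne').div_const _

lemma contMDiff_spiralTime (κ : ℂ) :
    ContMDiff 𝓘(ℝ, ℂ × ℂ) 𝓘(ℝ, ℝ) ω fun w : W => spiralTime κ w.1 := fun w =>
  (contDiffAt_spiralTime κ w.2).contMDiffAt.comp w contMDiff_W_val.contMDiffAt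

lemma contMDiff_polar {κ : ℂ} (hκ : κ.re ≠ 0) {v : ℂ × ℂ} (hv : qnorm v = 1) :
    ContMDiff 𝓘(ℝ, ℂ × ℂ) modelG ω fun w : W => polar κ v w.1 := by
  have hc : ContMDiff 𝓘(ℝ, ℂ × ℂ) 𝓘(ℝ, ℂ × ℂ) ω fun w : W => col (polar κ v w.1).2 := by
    have h1 : ContDiff ℝ ω fun x : ℝ × (ℂ × ℂ) =>
        qmulRight (qconj v) (Complex.exp (-(κ * Complex.ofRealCLM x.1)) • x.2) := by fun_prop
    refine (h1.contMDiff.comp ((contMDiff_spiralTime κ).prodMk_space contMDiff_W_val)).congr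
      fun w => ?_
    exact col_polar hκ hv w.2
  refine ContMDiff.prodMk (contMDiff_circleExp.comp (contMDiff_spiralTime κ)) ?_
  exact contMDiff_su2_of_column (contDiff_fst.contMDiff.comp hc) (contDiff_snd.contMDiff.comp hc)

lemma contMDiffAt_polar {κ : ℂ} (hκ : κ.re ≠ 0) {v : ℂ × ℂ} (hv : qnorm v = 1)
    {z : ℂ × ℂ} (hz : z ≠ 0) : ContMDiffAt 𝓘(ℝ, ℂ × ℂ) modelG ω (polar κ v) z :=
  contMDiffAt_of_W (contMDiff_polar hκ hv) hz

lemma contMDiff_col : ContMDiff (𝓡 3) 𝓘(ℝ, ℂ × ℂ) ω col := contMDiff_su2_column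

lemma contMDiff_circle_coe : ContMDiff (M := Circle) (𝓡 1) 𝓘(ℝ, ℂ) ω fun z => (z : ℂ) :=
  haveI := Complex.finrank_real_complex_fact
  contMDiff_coe_sphere (E := ℂ)

/-- The argument is the imaginary part of the logarithm, smooth off the cut; the hypothesis keeps p
away from the antipode of exp(it). -/
lemma contMDiffAt_spiral (κ : ℂ) (v : ℂ × ℂ) {t : ℝ} {p : G}
    (hp : ((p.1 * Circle.exp (-t) : Circle) : ℂ) ∈ Complex.slitPlane) :
    ContMDiffAt modelG 𝓘(ℝ, ℂ × ℂ) ω (spiral κ v t) p := by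
  have h1 : ContMDiffAt modelG 𝓘(ℝ, ℂ × (ℂ × ℂ)) ω
      (fun p : G => (((p.1 * Circle.exp (-t) : Circle) : ℂ), col p.2)) p := by
    apply ContMDiff.contMDiffAt
    refine ContMDiff.prodMk_space ?_ (contMDiff_col.comp contMDiff_snd)
    exact contMDiff_circle_coe.comp (contMDiff_fst.mul contMDiff_const)
  have h2 : ContDiffAt ℝ ω (fun x : ℂ × (ℂ × ℂ) =>
      Complex.exp (κ * Complex.ofRealCLM (t + Complex.imCLM (Complex.log x.1))) •
        qmulRight v x.2) (((p.1 * Circle.exp (-t) : Circle) : ℂ), col p.2) := by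
    have h3 : ContDiffAt ℝ ω (fun x : ℂ × (ℂ × ℂ) => Complex.log x.1)
        (((p.1 * Circle.exp (-t) : Circle) : ℂ), col p.2) :=
      ContDiffAt.comp (g := Complex.log) (f := Prod.fst) _
        ((Complex.contDiffAt_log hp).restrict_scalars ℝ) contDiffAt_fst
    have h4 : ContDiffAt ℝ ω (fun x : ℂ × (ℂ × ℂ) => Complex.exp (κ * Complex.ofRealCLM
        (t + Complex.imCLM (Complex.log x.1))))
        (((p.1 * Circle.exp (-t) : Circle) : ℂ), col p.2) := by
      fun_prop
    exact h4.smul (by fun_prop)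
  refine (h2.contMDiffAt.comp p h1).congr_of_eventuallyEq (Filter.Eventually.of_forall fun q => ?_)
  simp [spiral, Complex.log_im]

/-! ### The Lie algebra of `S¹ × SU(2)` -/

/-- The model vector space of `S¹ × SU(2)`. -/
abbrev ModelG : Type := EuclideanSpace ℝ (Fin 1) × EuclideanSpace ℝ (Fin 3)

lemma one_re_ne_zero : (1 : ℂ).re ≠ 0 := by simp

lemma qnorm_one : qnorm (1, 0) = 1 := by simp [qnorm]

lemma one_ne_zero' : ((1, 0) : ℂ × ℂ) ≠ 0 := by simp

/-- The homomorphism from the nonzero quaternions to `S¹ × SU(2)`. -/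
abbrev stdPolar : ℂ × ℂ → G := polar 1 (1, 0)

lemma exp_smul_stdPolar {z : ℂ × ℂ} (hz : z ≠ 0) :
    Complex.exp (spiralTime 1 z) • col (stdPolar z).2 = z := by
  have h := exp_smul_polar one_re_ne_zero qnorm_one hz
  rwa [qmul_one, one_mul] at h

lemma stdPolar_exp (s : ℝ) (A : SU2) :
    stdPolar (Complex.exp s • col A) = (Circle.exp s, A) := by
  have h := polar_exp one_re_ne_zero qnorm_one s A
  rwa [qmul_one, one_mul] at h

/-- The norm is multiplicative and the real factors exp(s) commute with all quaternions, so
logarithms of norms add and unit parts multiply. -/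
lemma stdPolar_qmul {z w : ℂ × ℂ} (hz : z ≠ 0) (hw : w ≠ 0) :
    stdPolar (qmul z w) = stdPolar z * stdPolar w := by
  have h : qmul z w = Complex.exp ((spiralTime 1 z + spiralTime 1 w : ℝ) : ℂ) •
      col ((stdPolar z).2 * (stdPolar w).2) := by
    conv_lhs => rw [← exp_smul_stdPolar hz, ← exp_smul_stdPolar hw]
    rw [col_mul, qmul_smul, Complex.ofReal_add, Complex.exp_add, mul_comm, mul_smul]
    congr 1
    ext1 <;> simp [qmul, ← Complex.exp_conj] <;> ring
  rw [h, stdPolar_exp, Circle.exp_add]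
  rfl

lemma stdPolar_one : stdPolar (1, 0) = 1 := by
  have h := stdPolar_exp 0 1
  have e : Complex.exp ((0 : ℝ) : ℂ) • col 1 = (1, 0) := by simp [col]
  rw [e, Circle.exp_zero] at h
  exact h

/-- Read through `stdPolar`, the spiral map is an explicit function on ℂ², which is how its
derivative is computed. The bound by π keeps the times in the branch centred at t. -/
lemma spiral_stdPolar (κ : ℂ) (v : ℂ × ℂ) {z : ℂ × ℂ} (hz : z ≠ 0) {t : ℝ}
    (ht : |spiralTime 1 z - t| < Real.pi) :
    spiral κ v t (stdPolar z) = Complex.exp ((κ - 1) * spiralTime 1 z) • qmul z v := by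
  have h : (stdPolar z).1 * Circle.exp (-t) = Circle.exp (spiralTime 1 z - t) := by
    rw [sub_eq_add_neg, Circle.exp_add]
    rfl
  rw [spiral, h, Circle.arg_exp (abs_lt.1 ht).1 (abs_lt.1 ht).2.le, add_sub_cancel,
    col_polar one_re_ne_zero qnorm_one hz]
  have e : qmul (Complex.exp (-(1 * (spiralTime 1 z : ℂ))) • z) (qconj (1, 0)) =
      Complex.exp (-(spiralTime 1 z : ℂ)) • z := by
    rw [one_mul, show qconj (1, 0) = (1, 0) by simp [qconj], qmul_one]
  have e' : qmul (Complex.exp (-(spiralTime 1 z : ℂ)) • z) v =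
      Complex.exp (-(spiralTime 1 z : ℂ)) • qmul z v := by
    ext1 <;> simp [qmul, ← Complex.exp_conj] <;> ring
  rw [e, e', smul_smul, ← Complex.exp_add]
  congr 2
  ring

lemma spiralTime_nhds {z : ℂ × ℂ} (hz : z ≠ 0) :
    ∀ᶠ y in nhds z, y ≠ 0 ∧ |spiralTime 1 y - spiralTime 1 z| < Real.pi := by
  have h := (contDiffAt_spiralTime 1 hz).continuousAt
  have h2 := Metric.continuousAt_iff'.1 h Real.pi Real.pi_pos
  filter_upwards [isOpen_ne.mem_nhds hz, h2] with y hy hy2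
  exact ⟨hy, hy2⟩

lemma contMDiffAt_stdPolar {z : ℂ × ℂ} (hz : z ≠ 0) :
    ContMDiffAt 𝓘(ℝ, ℂ × ℂ) modelG ω stdPolar z :=
  contMDiffAt_polar one_re_ne_zero qnorm_one hz

lemma contMDiffAt_spiral_stdPolar (κ : ℂ) (v z : ℂ × ℂ) :
    ContMDiffAt modelG 𝓘(ℝ, ℂ × ℂ) ω (spiral κ v (spiralTime 1 z)) (stdPolar z) := by
  apply contMDiffAt_spiral
  have h : (stdPolar z).1 * Circle.exp (-spiralTime 1 z) = 1 := by
    change Circle.exp _ * _ = _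
    rw [← Circle.exp_add, add_neg_cancel, Circle.exp_zero]
  rw [h]
  simp

lemma isInvertible_of_leftInverse {E F : Type*} [NormedAddCommGroup E] [NormedSpace ℝ E]
    [NormedAddCommGroup F] [NormedSpace ℝ F] [FiniteDimensional ℝ E] [FiniteDimensional ℝ F]
    (hdim : Module.finrank ℝ E = Module.finrank ℝ F) (f : E →L[ℝ] F) (g : F →L[ℝ] E)
    (hgf : ∀ x, g (f x) = x) : f.IsInvertible := by
  have hinj : Function.Injective f := Function.LeftInverse.injective hgf
  exact ⟨(LinearMap.linearEquivOfInjective (f : E →ₗ[ℝ] F) hinj hdim).toContinuousLinearEquiv, rfl⟩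

lemma finrank_modelG : Module.finrank ℝ (ℂ × ℂ) = Module.finrank ℝ ModelG := by
  simp [Complex.finrank_real_complex]

/-- The derivative of `stdPolar` at `z`, as a map between the model spaces. -/
def dPolar (z : ℂ × ℂ) : (ℂ × ℂ) →L[ℝ] ModelG := mfderiv 𝓘(ℝ, ℂ × ℂ) modelG stdPolar z

/-- For κ = 1 and v = 1 the spiral map is a smooth local left inverse of `stdPolar`, and the
dimensions agree. -/
lemma isInvertible_dPolar {z : ℂ × ℂ} (hz : z ≠ 0) : (dPolar z).IsInvertible := by
  have h1 : MDifferentiableAt 𝓘(ℝ, ℂ × ℂ) modelG stdPolar z :=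
    (contMDiffAt_stdPolar hz).mdifferentiableAt (by simp)
  have h2 : MDifferentiableAt modelG 𝓘(ℝ, ℂ × ℂ) (spiral 1 (1, 0) (spiralTime 1 z)) (stdPolar z) :=
    (contMDiffAt_spiral_stdPolar 1 (1, 0) z).mdifferentiableAt (by simp)
  have h3 : (spiral 1 (1, 0) (spiralTime 1 z) ∘ stdPolar) =ᶠ[nhds z] id := by
    filter_upwards [spiralTime_nhds hz] with y hy
    rw [Function.comp_apply, spiral_stdPolar _ _ hy.1 hy.2]
    simp [qmul_one]
  refine isInvertible_of_leftInverse finrank_modelG (dPolar z)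
    (mfderiv modelG 𝓘(ℝ, ℂ × ℂ) (spiral 1 (1, 0) (spiralTime 1 z)) (stdPolar z)) fun x => ?_
  have h4 := mfderiv_comp_apply z h2 h1 x
  rw [h3.mfderiv_eq, mfderiv_id] at h4
  exact h4.symm

/-- The derivative of `stdPolar` carries the vector field `z ↦ z u` to a left-invariant vector
field. -/
lemma dPolar_qmul {z : ℂ × ℂ} (hz : z ≠ 0) (u : ℂ × ℂ) :
    dPolar z (qmul z u) =
      (mulInvariantVectorField (I := modelG) (G := G) (dPolar (1, 0) u) (stdPolar z) : ModelG) := by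
  have h1 : MDifferentiableAt 𝓘(ℝ, ℂ × ℂ) modelG stdPolar (1, 0) :=
    (contMDiffAt_stdPolar one_ne_zero').mdifferentiableAt (by simp)
  have h2 : MDifferentiableAt 𝓘(ℝ, ℂ × ℂ) modelG stdPolar
      ((qmulLeft z).restrictScalars ℝ (1, 0)) := by
    apply (contMDiffAt_stdPolar _).mdifferentiableAt (by simp)
    simpa [qmul_one] using hz
  have h3 : MDifferentiableAt modelG modelG (stdPolar z * ·) (stdPolar (1, 0)) :=
    (contMDiff_mul_left (I := modelG) (n := ω)).contMDiffAt.mdifferentiableAt (by simp)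
  have h4 : MDifferentiableAt 𝓘(ℝ, ℂ × ℂ) 𝓘(ℝ, ℂ × ℂ) ((qmulLeft z).restrictScalars ℝ) (1, 0) :=
    ((qmulLeft z).restrictScalars ℝ).mdifferentiableAt
  have h5 : (stdPolar ∘ (qmulLeft z).restrictScalars ℝ) =ᶠ[nhds (1, 0)]
      ((stdPolar z * ·) ∘ stdPolar) := by
    filter_upwards [isOpen_ne.mem_nhds one_ne_zero'] with y hy
    exact stdPolar_qmul hz hy
  have h6 := mfderiv_comp_apply (1, 0) h2 h4 u
  have h7 := mfderiv_comp_apply (1, 0) h3 h1 u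
  rw [h5.mfderiv_eq] at h6
  have e1 : (mfderiv 𝓘(ℝ, ℂ × ℂ) modelG stdPolar ((qmulLeft z).restrictScalars ℝ (1, 0)) :
      (ℂ × ℂ) →L[ℝ] ModelG) = dPolar z := mfderiv_congr_point (qmul_one z)
  have e2 : (mfderiv 𝓘(ℝ, ℂ × ℂ) 𝓘(ℝ, ℂ × ℂ) ((qmulLeft z).restrictScalars ℝ) (1, 0) u : ℂ × ℂ) =
      qmul z u := by
    rw [mfderiv_eq_fderiv, ContinuousLinearMap.fderiv]
    rfl
  have e3 : (mfderiv modelG modelG (stdPolar z * ·) (stdPolar (1, 0)) : ModelG →L[ℝ] ModelG) =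
      mfderiv modelG modelG (stdPolar z * ·) 1 := mfderiv_congr_point stdPolar_one
  rw [← e1, ← e2]
  refine h6.symm.trans (h7.trans ?_)
  exact DFunLike.congr_fun e3 _

/-- The isomorphism from the quaternions to the Lie algebra of `S¹ × SU(2)` given by the
derivative of `stdPolar`. -/
def quaternionEquiv : (ℂ × ℂ) ≃ₗ[ℝ] 𝔤 :=
  (LinearEquiv.ofBijective (dPolar (1, 0) : (ℂ × ℂ) →ₗ[ℝ] ModelG)
    (isInvertible_dPolar one_ne_zero').bijective : (ℂ × ℂ) ≃ₗ[ℝ] ModelG)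

lemma mpullback_stdPolar {z : ℂ × ℂ} (hz : z ≠ 0) (u : ℂ × ℂ) :
    VectorField.mpullback 𝓘(ℝ, ℂ × ℂ) modelG stdPolar
      (mulInvariantVectorField (quaternionEquiv u)) z = qmul z u := by
  have h := (isInvertible_dPolar hz).inverse_apply_self (qmul z u)
  rw [dPolar_qmul hz] at h
  exact h

lemma mlieBracket_eq_lieBracket {E : Type*} [NormedAddCommGroup E] [NormedSpace ℝ E]
    (V V' : (x : E) → TangentSpace 𝓘(ℝ, E) x) :
    VectorField.mlieBracket 𝓘(ℝ, E) V V' = VectorField.lieBracket ℝ V V' := by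
  rw [← VectorField.mlieBracketWithin_univ, VectorField.mlieBracketWithin_eq_lieBracketWithin]
  exact VectorField.lieBracketWithin_univ

/-- Left-invariant fields pull back to the linear fields z ↦ zu, and pullback commutes with
brackets. At 1 the bracket of z ↦ zu and z ↦ zw is uw - wu. -/
lemma isQuaternionic_quaternionEquiv : IsQuaternionic quaternionEquiv := fun u w => by
  have hpb (x : ℂ × ℂ) : VectorField.mpullback 𝓘(ℝ, ℂ × ℂ) modelG stdPolar
      (mulInvariantVectorField (quaternionEquiv x)) =ᶠ[nhds (1, 0)] qmulRight x := by
    filter_upwards [isOpen_ne.mem_nhds one_ne_zero'] with y hy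
    exact mpullback_stdPolar hy x
  have h1 := VectorField.mpullback_mlieBracket (n := ω) (x₀ := ((1, 0) : ℂ × ℂ))
    (mdifferentiableAt_mulInvariantVectorField (I := modelG) (G := G) (quaternionEquiv u)
      (g := stdPolar (1, 0)))
    (mdifferentiableAt_mulInvariantVectorField (I := modelG) (G := G) (quaternionEquiv w)
      (g := stdPolar (1, 0)))
    (contMDiffAt_stdPolar one_ne_zero') (by simp)
  have hlie : VectorField.lieBracket ℝ (qmulRight u) (qmulRight w) (1, 0) =
      qmul u w - qmul w u := by
    rw [VectorField.lieBracket, ContinuousLinearMap.fderiv, ContinuousLinearMap.fderiv]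
    simp [one_qmul]
  rw [(hpb u).mlieBracket_vectorField_eq (hpb w)] at h1
  have h2 : (dPolar (1, 0)).inverse (VectorField.mlieBracket modelG
      (mulInvariantVectorField (quaternionEquiv u)) (mulInvariantVectorField (quaternionEquiv w))
      (stdPolar (1, 0)) : ModelG) = qmul u w - qmul w u := by
    exact h1.trans ((congrFun (mlieBracket_eq_lieBracket _ _) _).trans hlie)
  have h3 (g : G) (hg : g = 1) : (VectorField.mlieBracket modelG
      (mulInvariantVectorField (quaternionEquiv u)) (mulInvariantVectorField (quaternionEquiv w))
      g : ModelG) = (⁅quaternionEquiv u, quaternionEquiv w⁆ : 𝔤) := by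
    subst hg
    rfl
  exact (h3 _ stdPolar_one).symm.trans
    ((isInvertible_dPolar one_ne_zero').inverse_apply_eq.1 h2)

lemma hasFDerivAt_spiralTime_one : HasFDerivAt (spiralTime 1)
    (Complex.reCLM ∘L ContinuousLinearMap.fst ℝ ℂ ℂ) (1, 0) := by
  have hre1 : HasFDerivAt (fun z : ℂ × ℂ => z.1.re)
    (Complex.reCLM ∘L ContinuousLinearMap.fst ℝ ℂ ℂ) (1, 0) :=
    (Complex.reCLM ∘L ContinuousLinearMap.fst ℝ ℂ ℂ).hasFDerivAt
  have him1 : HasFDerivAt (fun z : ℂ × ℂ => z.1.im)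
    (Complex.imCLM ∘L ContinuousLinearMap.fst ℝ ℂ ℂ) (1, 0) :=
    (Complex.imCLM ∘L ContinuousLinearMap.fst ℝ ℂ ℂ).hasFDerivAt
  have hre2 : HasFDerivAt (fun z : ℂ × ℂ => z.2.re)
    (Complex.reCLM ∘L ContinuousLinearMap.snd ℝ ℂ ℂ) (1, 0) :=
    (Complex.reCLM ∘L ContinuousLinearMap.snd ℝ ℂ ℂ).hasFDerivAt
  have him2 : HasFDerivAt (fun z : ℂ × ℂ => z.2.im)
    (Complex.imCLM ∘L ContinuousLinearMap.snd ℝ ℂ ℂ) (1, 0) :=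
    (Complex.imCLM ∘L ContinuousLinearMap.snd ℝ ℂ ℂ).hasFDerivAt
  have hq := ((hre1.mul hre1).add (him1.mul him1)).add ((hre2.mul hre2).add (him2.mul him2))
  have h := (hq.log (by simp)).mul_const (2 : ℝ)⁻¹
  refine (h.congr_of_eventuallyEq (Filter.Eventually.of_forall fun z => ?_)).congr_fderiv ?_
  · simp [spiralTime, qnorm, Complex.normSq_apply, div_eq_mul_inv]
  · ext x <;> simp
    ring

/-- The derivative at `1` of `(exp (i s), A) ↦ exp (κ s) A v`, on quaternions. -/
lemma mfderiv_spiral_quaternionEquiv (κ : ℂ) (v u : ℂ × ℂ) :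
    (mfderiv modelG 𝓘(ℝ, ℂ × ℂ) (spiral κ v 0) 1 (quaternionEquiv u) : ℂ × ℂ) =
      ((κ - 1) * u.1.re) • v + qmul u v := by
  have ht : spiralTime 1 (1, 0) = 0 := by simp [spiralTime, qnorm]
  have h1 : MDifferentiableAt 𝓘(ℝ, ℂ × ℂ) modelG stdPolar (1, 0) :=
    (contMDiffAt_stdPolar one_ne_zero').mdifferentiableAt (by simp)
  have h2 : MDifferentiableAt modelG 𝓘(ℝ, ℂ × ℂ) (spiral κ v 0) (stdPolar (1, 0)) := by
    have h := (contMDiffAt_spiral_stdPolar κ v (1, 0)).mdifferentiableAt (by simp)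
    rwa [ht] at h
  have h3 : (spiral κ v 0 ∘ stdPolar) =ᶠ[nhds (1, 0)]
      fun z => Complex.exp ((κ - 1) * spiralTime 1 z) • qmul z v := by
    filter_upwards [spiralTime_nhds one_ne_zero'] with y hy
    rw [ht] at hy
    exact spiral_stdPolar _ _ hy.1 hy.2
  have h4 : HasFDerivAt (fun z => Complex.exp ((κ - 1) * spiralTime 1 z) • qmul z v)
      (qmulRight v + ((κ - 1) • Complex.ofRealCLM ∘L Complex.reCLM ∘L
        ContinuousLinearMap.fst ℝ ℂ ℂ).smulRight v) (1, 0) := by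
    have hexp :=
      ((Complex.ofRealCLM.hasFDerivAt.comp _ hasFDerivAt_spiralTime_one).const_mul (κ - 1)).cexp
    refine (hexp.smul (qmulRight v).hasFDerivAt).congr_fderiv ?_
    ext x <;> simp [ht, one_qmul, mul_assoc]
  have h5 := mfderiv_comp_apply (1, 0) h2 h1 u
  rw [h3.mfderiv_eq, mfderiv_eq_fderiv, h4.fderiv] at h5
  have e : (mfderiv modelG 𝓘(ℝ, ℂ × ℂ) (spiral κ v 0) (stdPolar (1, 0)) : ModelG →L[ℝ] (ℂ × ℂ)) =
      mfderiv modelG 𝓘(ℝ, ℂ × ℂ) (spiral κ v 0) 1 := mfderiv_congr_point stdPolar_one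
  refine (DFunLike.congr_fun e _).symm.trans (h5.symm.trans ?_)
  rw [add_comm]
  rfl

/-! ### Maps to and from the Hopf surface -/

/-- The projection from `W` to the Hopf surface. -/
abbrev hopfMk (lam : Multiplier) (w : W) : HopfSurface lam :=
  Quotient.mk (MulAction.orbitRel (Gam lam) W) w

lemma hopfMk_smul (lam : Multiplier) (a : Gam lam) (w : W) :
    hopfMk lam (a • w) = hopfMk lam w :=
  Quotient.sound ⟨a, rfl⟩

lemma chartAt_hopf_symm (lam : Multiplier) (p : HopfSurface lam) {x : ℂ × ℂ}
    (hx : x ∈ (chartAt (ℂ × ℂ) p).target) :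
    ∃ h : x ≠ 0, (chartAt (ℂ × ℂ) p).symm x = hopfMk lam ⟨x, h⟩ := by
  obtain ⟨w, A, hA, hp⟩ : ∃ (w : W) (A : OpenPartialHomeomorph (HopfSurface lam) W),
      ⇑A.symm = hopfMk lam ∧ chartAt (ℂ × ℂ) p = A.trans (chartAt (ℂ × ℂ) w) :=
    ⟨_, _, IsLocalHomeomorph.localInverseAt_symm _ _, rfl⟩
  rw [hp] at hx ⊢
  have hxc : x ∈ (chartAt (ℂ × ℂ) w).target := by
    rw [OpenPartialHomeomorph.trans_target] at hx
    exact hx.1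
  have h : ((chartAt (ℂ × ℂ) w).symm x).1 = x := (chartAt (ℂ × ℂ) w).right_inv hxc
  have hx0 : x ≠ 0 := h ▸ ((chartAt (ℂ × ℂ) w).symm x).2
  refine ⟨hx0, ?_⟩
  change A.symm ((chartAt (ℂ × ℂ) w).symm x) = _
  rw [hA]
  exact congrArg _ (Subtype.ext h)

/-- A chart inverts the projection only up to the deck group, hence the factor a, a power of λ that
is constant near w₀. -/
lemma chartAt_hopf_hopfMk (lam : Multiplier) (w₀ : W) :
    ∃ a : ℂ, ∀ᶠ w in nhds w₀, chartAt (ℂ × ℂ) (hopfMk lam w₀) (hopfMk lam w) = a • w.1 := by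
  have hsrc := mem_chart_source (ℂ × ℂ) (hopfMk lam w₀)
  obtain ⟨w, A, hA, hp⟩ : ∃ (w : W) (A : OpenPartialHomeomorph (HopfSurface lam) W),
      ⇑A.symm = hopfMk lam ∧
        chartAt (ℂ × ℂ) (hopfMk lam w₀) = A.trans (chartAt (ℂ × ℂ) w) :=
    ⟨_, _, IsLocalHomeomorph.localInverseAt_symm _ _, rfl⟩
  rw [hp] at hsrc
  have hA0 : hopfMk lam w₀ ∈ A.source := by
    rw [OpenPartialHomeomorph.trans_source] at hsrc
    exact hsrc.1
  have h1 := A.left_inv hA0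
  rw [hA] at h1
  obtain ⟨a, ha⟩ := Quotient.exact h1
  have hmem : a • w₀ ∈ A.target := by
    have h2 := A.map_source hA0
    rwa [← ha] at h2
  have hev : ∀ᶠ y in nhds w₀, a • y ∈ A.target :=
    (continuous_const_smul a).continuousAt.eventually_mem (A.open_target.mem_nhds hmem)
  refine ⟨((a : ℂˣ) : ℂ), ?_⟩
  filter_upwards [hev] with y hy
  rw [hp, ← hopfMk_smul lam a y, ← hA]
  change (A (A.symm (a • y))).1 = _
  rw [A.right_inv hy]
  rfl

/-- The derivative of a map between manifolds, as a map between the model spaces. -/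
def modelDeriv {E H M E' H' M' : Type*} [NormedAddCommGroup E] [NormedSpace ℝ E]
    [TopologicalSpace H] (I : ModelWithCorners ℝ E H) [TopologicalSpace M] [ChartedSpace H M]
    [NormedAddCommGroup E'] [NormedSpace ℝ E'] [TopologicalSpace H'] (I' : ModelWithCorners ℝ E' H')
    [TopologicalSpace M'] [ChartedSpace H' M'] (f : M → M') (x : M) : E →L[ℝ] E' :=
  mfderiv I I' f x

/-- A map to the Hopf surface that lifts to a smooth map to `ℂ² ∖ {0}` is smooth, and its
derivative is a complex multiple of the derivative of the lift. -/
lemma contMDiffAt_hopfMk (lam : Multiplier) {E H M : Type*} [NormedAddCommGroup E]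
    [NormedSpace ℝ E] [TopologicalSpace H] {I : ModelWithCorners ℝ E H} [TopologicalSpace M]
    [ChartedSpace H M] {F : M → ℂ × ℂ} (hF : ∀ y, F y ≠ 0) {f : M → HopfSurface lam}
    (hf : ∀ y, f y = hopfMk lam ⟨F y, hF y⟩) {x : M} {n : WithTop ℕ∞} (hn : n ≠ 0)
    (hFx : ContMDiffAt I 𝓘(ℝ, ℂ × ℂ) n F x) :
    ContMDiffAt I 𝓘(ℝ, ℂ × ℂ) n f x ∧ ∃ a : ℂ, ∀ u : E,
      modelDeriv I 𝓘(ℝ, ℂ × ℂ) f x u = a • modelDeriv I 𝓘(ℝ, ℂ × ℂ) F x u := by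
  obtain rfl : f = fun y => hopfMk lam ⟨F y, hF y⟩ := funext hf
  obtain ⟨a, ha⟩ := chartAt_hopf_hopfMk lam ⟨F x, hF x⟩
  have hc : ContinuousAt (fun y => (⟨F y, hF y⟩ : W)) x :=
    hFx.continuousAt.codRestrict hF
  have hcf : ContinuousAt (fun y => hopfMk lam ⟨F y, hF y⟩) x :=
    continuous_quotient_mk'.continuousAt.comp hc
  have hev : (extChartAt 𝓘(ℝ, ℂ × ℂ) (hopfMk lam ⟨F x, hF x⟩) ∘
      fun y => hopfMk lam ⟨F y, hF y⟩) =ᶠ[nhds x] fun y => a • F y := by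
    filter_upwards [hc.eventually ha] with y hy
    simpa using hy
  have hs : ContMDiffAt I 𝓘(ℝ, ℂ × ℂ) n (fun y => a • F y) x :=
    ((a • ContinuousLinearMap.id ℂ (ℂ × ℂ)).restrictScalars ℝ).contDiff.contMDiff.contMDiffAt.comp
      x hFx
  have hf' : ContMDiffAt I 𝓘(ℝ, ℂ × ℂ) n (fun y => hopfMk lam ⟨F y, hF y⟩) x := by
    rw [contMDiffAt_iff_target]
    exact ⟨hcf, hs.congr_of_eventuallyEq hev⟩
  refine ⟨hf', a, fun u => ?_⟩
  have hd1 := hf'.mdifferentiableAt hn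
  have hd2 := (hs.congr_of_eventuallyEq hev).mdifferentiableAt hn
  have h1 : modelDeriv I 𝓘(ℝ, ℂ × ℂ) (fun y => hopfMk lam ⟨F y, hF y⟩) x =
      modelDeriv I 𝓘(ℝ, ℂ × ℂ) (extChartAt 𝓘(ℝ, ℂ × ℂ) (hopfMk lam ⟨F x, hF x⟩) ∘
        fun y => hopfMk lam ⟨F y, hF y⟩) x :=
    hd1.mfderiv.trans hd2.mfderiv.symm
  have h2 := mfderiv_comp_apply (I' := 𝓘(ℝ, ℂ × ℂ)) (I'' := 𝓘(ℝ, ℂ × ℂ)) x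
    (g := (a • ContinuousLinearMap.id ℂ (ℂ × ℂ)).restrictScalars ℝ)
    (ContinuousLinearMap.mdifferentiableAt _) (hFx.mdifferentiableAt hn) u
  rw [mfderiv_eq_fderiv, ContinuousLinearMap.fderiv] at h2
  rw [h1]
  exact (DFunLike.congr_fun hev.mfderiv_eq u).trans h2

/-- A map on the Hopf surface is smooth if its composition with the projection is. -/
lemma contMDiff_of_hopfMk (lam : Multiplier) {E H M : Type*} [NormedAddCommGroup E]
    [NormedSpace ℝ E] [TopologicalSpace H] {I : ModelWithCorners ℝ E H} [TopologicalSpace M]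
    [ChartedSpace H M] {k : HopfSurface lam → M} {K : ℂ × ℂ → M} {n : WithTop ℕ∞}
    (hK : ∀ z ≠ 0, ContMDiffAt 𝓘(ℝ, ℂ × ℂ) I n K z) (hk : ∀ w, k (hopfMk lam w) = K w.1) :
    ContMDiff 𝓘(ℝ, ℂ × ℂ) I n k := by
  intro p
  rw [contMDiffAt_iff_source]
  have ht : extChartAt 𝓘(ℝ, ℂ × ℂ) p p ∈ (chartAt (ℂ × ℂ) p).target := by
    simp
  obtain ⟨h0, -⟩ := chartAt_hopf_symm lam p ht
  refine ContMDiffAt.contMDiffWithinAt ((hK _ h0).congr_of_eventuallyEq ?_)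
  filter_upwards [(chartAt (ℂ × ℂ) p).open_target.mem_nhds ht] with y hy
  obtain ⟨hy0, hy'⟩ := chartAt_hopf_symm lam p hy
  have : (extChartAt 𝓘(ℝ, ℂ × ℂ) p).symm y = hopfMk lam ⟨y, hy0⟩ := hy'
  rw [Function.comp_apply, this, hk]

/-! ### The biholomorphism -/

/-- The multiplier `exp (2 π κ)`. -/
def expMultiplier (κ : ℂ) (hκ : κ.re ≠ 0) : Multiplier :=
  ⟨Units.mk0 (Complex.exp (κ * (2 * Real.pi : ℝ))) (Complex.exp_ne_zero _), by
    rw [Units.val_mk0, Complex.norm_exp, Complex.re_mul_ofReal, ne_eq, Real.exp_eq_one_iff]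
    have := Real.pi_pos
    positivity⟩

section

variable {κ : ℂ} (hκ : κ.re ≠ 0)

lemma expMultiplier_zpow (m : ℤ) :
    ((((expMultiplier κ hκ).1 ^ m : ℂˣ)) : ℂ) = Complex.exp (κ * (m * (2 * Real.pi) : ℝ)) := by
  rw [Units.val_zpow_eq_zpow_val, expMultiplier, Units.val_mk0, ← Complex.exp_int_mul]
  congr 1
  push_cast
  ring

/-- Times with the same image on the circle differ by 2πm, which multiplies the point by exp(2πκm) =
λ^m. -/
lemma hopfMk_exp_eq {s s' : ℝ} (hs : Circle.exp s = Circle.exp s') {z w w' : ℂ × ℂ}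
    (hw : w ≠ 0) (hw' : w' ≠ 0) (e : w = Complex.exp (κ * s) • z)
    (e' : w' = Complex.exp (κ * s') • z) :
    hopfMk (expMultiplier κ hκ) ⟨w, hw⟩ = hopfMk (expMultiplier κ hκ) ⟨w', hw'⟩ := by
  obtain ⟨m, hm⟩ := Circle.exp_eq_exp.1 hs
  have h : (⟨w, hw⟩ : W) =
      (⟨(expMultiplier κ hκ).1 ^ m, m, rfl⟩ : Gam (expMultiplier κ hκ)) • ⟨w', hw'⟩ := by
    apply Subtype.ext
    change w = (((expMultiplier κ hκ).1 ^ m : ℂˣ) : ℂ) • w'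
    rw [expMultiplier_zpow, e, e', smul_smul, ← Complex.exp_add, hm]
    congr 2
    push_cast
    ring
  rw [h, hopfMk_smul]

variable {v : ℂ × ℂ} (hv : qnorm v = 1)

/-- The map `(exp (i s), A) ↦ [exp (κ s) A v]` to the Hopf surface. -/
def toHopf (p : G) : HopfSurface (expMultiplier κ hκ) :=
  hopfMk _ ⟨spiral κ v 0 p, spiral_ne_zero hv 0 p⟩

/-- The branch of s does not matter in the quotient, so near each point one smooth there may be
used. -/
lemma toHopf_eq (t : ℝ) (p : G) :
    toHopf hκ hv p = hopfMk _ ⟨spiral κ v t p, spiral_ne_zero hv t p⟩ := by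
  refine hopfMk_exp_eq hκ ?_ _ _ rfl rfl
  rw [Circle.exp_add, Circle.exp_add, Circle.exp_arg, Circle.exp_arg, Circle.exp_neg,
    Circle.exp_neg]
  simp

lemma polar_smul (hv : qnorm v = 1) (w : W) (a : Gam (expMultiplier κ hκ)) :
    polar κ v (a • w).1 = polar κ v w.1 := by
  obtain ⟨_, m, rfl⟩ := a
  have h : ((⟨(expMultiplier κ hκ).1 ^ m, m, rfl⟩ : Gam (expMultiplier κ hκ)) • w).1 =
      Complex.exp (κ * (spiralTime κ w.1 + m * (2 * Real.pi) : ℝ)) •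
        qmul (col (polar κ v w.1).2) v := by
    change (((expMultiplier κ hκ).1 ^ m : ℂˣ) : ℂ) • w.1 = _
    conv_lhs => rw [← exp_smul_polar hκ hv w.2]
    rw [expMultiplier_zpow, smul_smul, ← Complex.exp_add]
    congr 2
    push_cast
    ring
  rw [h, polar_exp hκ hv, Circle.exp_add, Circle.exp_int_mul_two_pi, mul_one]
  rfl

/-- The inverse of `toHopf`. -/
def ofHopf (q : HopfSurface (expMultiplier κ hκ)) : G :=
  Quotient.lift (fun w : W => polar κ v w.1) (by
    rintro w w' ⟨a, rfl⟩
    exact polar_smul hκ hv w' a) q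

lemma ofHopf_hopfMk (w : W) : ofHopf hκ hv (hopfMk _ w) = polar κ v w.1 := rfl

lemma contMDiffAt_spiral_arg (p : G) :
    ContMDiffAt modelG 𝓘(ℝ, ℂ × ℂ) ω (spiral κ v (Complex.arg p.1)) p := by
  apply contMDiffAt_spiral
  rw [Circle.exp_neg, Circle.exp_arg, mul_inv_cancel]
  simp

/-- The diffeomorphism from `S¹ × SU(2)` to the Hopf surface. -/
def hopfDiffeomorph :
    G ≃ₘ^∞⟮modelG, 𝓘(ℝ, ℂ × ℂ)⟯ HopfSurface (expMultiplier κ hκ) where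
  toFun := toHopf hκ hv
  invFun := ofHopf hκ hv
  left_inv p := polar_spiral hκ hv 0 p
  right_inv q := by
    obtain ⟨w, rfl⟩ := Quotient.mk_surjective q
    refine hopfMk_exp_eq hκ ?_ _ w.2 rfl (exp_smul_polar hκ hv w.2).symm
    rw [Circle.exp_add, Circle.exp_arg, Circle.exp_neg]
    simp
    rfl
  contMDiff_toFun p := ((contMDiffAt_hopfMk _ (spiral_ne_zero hv (Complex.arg p.1))
    (toHopf_eq hκ hv (Complex.arg p.1)) (by simp) (contMDiffAt_spiral_arg p)).1).of_le le_top
  contMDiff_invFun := (contMDiff_of_hopfMk _ (fun _ hz => contMDiffAt_polar hκ hv hz)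
    (ofHopf_hopfMk hκ hv)).of_le le_top

/-- Left translation by p becomes a ℂ-linear map of ℂ²: left quaternion multiplication commutes with
complex scalars. This reduces the holomorphy of the spiral map to the identity of `G`. -/
lemma spiral_arg_mul (κ : ℂ) (v : ℂ × ℂ) (p q : G) : spiral κ v (Complex.arg p.1) (p * q) =
    (Complex.exp (κ * Complex.arg p.1) • qmulLeft (col p.2)) (spiral κ v 0 q) := by
  have h : (p * q).1 * Circle.exp (-Complex.arg p.1) = q.1 := by
    rw [Circle.exp_neg, Circle.exp_arg, Prod.fst_mul, mul_comm p.1, mul_inv_cancel_right]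
  rw [spiral, h, spiral, neg_zero, Circle.exp_zero, mul_one, zero_add, Prod.snd_mul, col_mul]
  simp only [FunLike.coe_smul, Pi.smul_apply, qmulLeft_apply, qmul_smul, smul_smul,
    ← Complex.exp_add, qmul_assoc]
  congr 2
  push_cast
  ring

lemma mfderiv_spiral_mulInvariantVectorField (κ : ℂ) (v : ℂ × ℂ) (p : G) (U : 𝔤) :
    modelDeriv modelG 𝓘(ℝ, ℂ × ℂ) (spiral κ v (Complex.arg p.1)) p
      (mulInvariantVectorField U p) = (Complex.exp (κ * Complex.arg p.1) • qmulLeft (col p.2))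
        (modelDeriv modelG 𝓘(ℝ, ℂ × ℂ) (spiral κ v 0) 1 U) := by
  have h1 : MDifferentiableAt modelG 𝓘(ℝ, ℂ × ℂ) (spiral κ v (Complex.arg p.1)) (p * 1) := by
    rw [mul_one]
    exact (contMDiffAt_spiral_arg p).mdifferentiableAt (by simp)
  have h2 : MDifferentiableAt modelG modelG (p * ·) (1 : G) :=
    (contMDiff_mul_left (I := modelG) (n := ω)).contMDiffAt.mdifferentiableAt (by simp)
  have h3 : MDifferentiableAt modelG 𝓘(ℝ, ℂ × ℂ) (spiral κ v 0) (1 : G) := by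
    have h := (contMDiffAt_spiral_arg (κ := κ) (v := v) 1).mdifferentiableAt (by simp)
    simpa using h
  have h4 := mfderiv_comp_apply (1 : G) h1 h2 U
  have h5 : (spiral κ v (Complex.arg p.1) ∘ (p * ·)) =
      ((Complex.exp (κ * Complex.arg p.1) • qmulLeft (col p.2)).restrictScalars ℝ :
        (ℂ × ℂ) →L[ℝ] (ℂ × ℂ)) ∘ spiral κ v 0 :=
    funext fun q => spiral_arg_mul κ v p q
  have h6 := mfderiv_comp_apply (I'' := 𝓘(ℝ, ℂ × ℂ)) (1 : G)
    (g := ((Complex.exp (κ * Complex.arg p.1) • qmulLeft (col p.2)).restrictScalars ℝ :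
        (ℂ × ℂ) →L[ℝ] (ℂ × ℂ))) (ContinuousLinearMap.mdifferentiableAt _) h3 U
  rw [mfderiv_eq_fderiv, ContinuousLinearMap.fderiv] at h6
  rw [h5] at h4
  have e : (mfderiv modelG 𝓘(ℝ, ℂ × ℂ) (spiral κ v (Complex.arg p.1)) (p * 1) :
      ModelG →L[ℝ] (ℂ × ℂ)) = mfderiv modelG 𝓘(ℝ, ℂ × ℂ) (spiral κ v (Complex.arg p.1)) p :=
    mfderiv_congr_point (mul_one p)
  exact (DFunLike.congr_fun e _).symm.trans (h4.symm.trans h6)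

/-- The derivative at p is the derivative at 1 followed by ℂ-linear maps, left multiplication and
the scalar from the chart; both commute with i. -/
lemma isBiholomorphism_hopfDiffeomorph {J : 𝔤 →ₗ[ℝ] 𝔤}
    (hJ : ∀ U, modelDeriv modelG 𝓘(ℝ, ℂ × ℂ) (spiral κ v 0) 1 (J U) =
      Complex.I • modelDeriv modelG 𝓘(ℝ, ℂ × ℂ) (spiral κ v 0) 1 U) :
    IsBiholomorphism J (hopfDiffeomorph hκ hv) := by
  intro p U
  obtain ⟨a, ha⟩ := (contMDiffAt_hopfMk _ (spiral_ne_zero hv (Complex.arg p.1))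
    (toHopf_eq hκ hv (Complex.arg p.1)) (by simp) (contMDiffAt_spiral_arg p)).2
  have h1 := ha (mulInvariantVectorField (J U) p)
  have h2 := ha (mulInvariantVectorField U p)
  rw [mfderiv_spiral_mulInvariantVectorField] at h1 h2
  rw [hJ, map_smul, smul_comm, ← h2] at h1
  exact h1

end

/-- The derivative at 1 sends the conjugate of z by v to v(z₁ + (κ - 1) Re z₁, z₂). In the second
component J is already i. In the first, 1 ↦ κ and J1 ↦ κa + bi, so the condition is κa + bi = iκ,
that is κ = b(1 - ai)/(1 + a²). -/
lemma mfderiv_spiral_normalForm {J : 𝔤 →ₗ[ℝ] 𝔤} (hJ : IsComplexStructure J) {v : ℂ × ℂ}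
    (hv : qnorm v = 1) {a b : ℝ} (hb : b ≠ 0)
    (h1 : J (quaternionEquiv (qAd v hv (1, 0))) = quaternionEquiv (qAd v hv (⟨a, b⟩, 0)))
    (h2 : ∀ w, J (quaternionEquiv (qAd v hv (0, w))) =
      quaternionEquiv (qAd v hv (0, Complex.I * w)))
    {κ : ℂ} (hκ : κ = b * (1 - a * Complex.I) / (1 + a ^ 2)) (U : 𝔤) :
    modelDeriv modelG 𝓘(ℝ, ℂ × ℂ) (spiral κ v 0) 1 (J U) =
      Complex.I • modelDeriv modelG 𝓘(ℝ, ℂ × ℂ) (spiral κ v 0) 1 U := by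
  have hD (z : ℂ × ℂ) : modelDeriv modelG 𝓘(ℝ, ℂ × ℂ) (spiral κ v 0) 1
      (quaternionEquiv (qAd v hv z)) = qmul v (z.1 + (κ - 1) * z.1.re, z.2) := by
    refine (mfderiv_spiral_quaternionEquiv κ v (qAd v hv z)).trans ?_
    rw [qAd_qmul_self, re_qAd]
    have e : ((z.1 + (κ - 1) * z.1.re, z.2) : ℂ × ℂ) =
        ((κ - 1) * z.1.re) • ((1 : ℂ), (0 : ℂ)) + z := by
      ext1 <;> simp [add_comm]
    rw [e, qmul_add, qmul_smul, qmul_one]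
  obtain ⟨z, rfl⟩ := ((qAd v hv).trans quaternionEquiv).surjective U
  have hJz := hJ.apply_normalForm (ι := (qAd v hv).trans quaternionEquiv) hb h1 h2 z
  rw [hJz]
  simp only [LinearEquiv.trans_apply]
  rw [hD, hD, ← qmul_smul]
  congr 1
  have ha : (1 : ℂ) + a ^ 2 ≠ 0 := by
    have : (1 : ℝ) + a ^ 2 ≠ 0 := by positivity
    exact_mod_cast this
  have hbC : (b : ℂ) ≠ 0 := by exact_mod_cast hb
  ext1
  · have e (x y : ℝ) : (⟨x, y⟩ : ℂ) = x + y * Complex.I := by apply Complex.ext <;> simp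
    have e' : z.1 = z.1.re + z.1.im * Complex.I := (Complex.re_add_im z.1).symm
    simp only [Prod.smul_mk, smul_eq_mul]
    rw [e]
    conv_rhs => rw [e']
    simp only [Complex.add_re, Complex.ofReal_re, Complex.mul_re, Complex.I_re, Complex.I_im,
      Complex.ofReal_im, mul_zero, mul_one, sub_zero, add_zero]
    rw [hκ]
    push_cast
    field_simp
    ring_nf
    simp only [Complex.I_sq]
    ring
  · rfl

end HopfLCK

end

theorem proposition3 (J : HopfLCK.𝔤 →ₗ[ℝ] HopfLCK.𝔤) (hJ : HopfLCK.IsComplexStructure J) :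
    (∃ (Ω : LinearMap.BilinForm ℝ HopfLCK.𝔤) (θ φ : Module.Dual ℝ HopfLCK.𝔤) (ξ : HopfLCK.𝔤),
      HopfLCK.IsLCK J Ω θ ∧
      HopfLCK.IsDualField (HopfLCK.metric J Ω) θ ξ ∧
      HopfLCK.metric J Ω ξ ξ = 1 ∧
      HopfLCK.IsDualField (HopfLCK.metric J Ω) φ (J ξ) ∧
      ∀ U V, Ω U V = -HopfLCK.wedge₁₁ θ φ U V + HopfLCK.d₁ φ U V) ∧
    (∃ (lam : HopfLCK.Multiplier)
      (f : Diffeomorph HopfLCK.modelG (modelWithCornersSelf ℝ (ℂ × ℂ)) HopfLCK.G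
        (HopfLCK.HopfSurface lam) ((⊤ : ℕ∞) : WithTop ℕ∞)),
      HopfLCK.IsBiholomorphism J f) ∧
    (∀ (Ω : LinearMap.BilinForm ℝ HopfLCK.𝔤) (θ : Module.Dual ℝ HopfLCK.𝔤),
      HopfLCK.IsLCK J Ω θ → HopfLCK.IsVaisman J Ω θ) := by
  obtain ⟨v, hv, a, b, hb, h1, h2⟩ :=
    hJ.exists_normalForm HopfLCK.isQuaternionic_quaternionEquiv
  have hι := HopfLCK.isQuaternionic_quaternionEquiv.qAd v hv
  refine ⟨HopfLCK.exists_lck_of_normalForm hι hJ hb h1 h2, ?_,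
    fun Ω θ hΩ => hΩ.isVaisman_of_normalForm hι hJ h1 h2⟩
  -- Since b ≠ 0, Re κ = b/(1 + a²) is nonzero, which is |λ| ≠ 1 for λ = exp(2πκ).
  have hre : ((b : ℂ) * (1 - a * Complex.I) / (1 + a ^ 2)).re = b / (1 + a ^ 2) := by
    have e : (b : ℂ) * (1 - a * Complex.I) / (1 + a ^ 2) =
        (b / (1 + a ^ 2) : ℝ) * (1 - a * Complex.I) := by
      push_cast
      ring
    rw [e, Complex.re_ofReal_mul]
    simp
  have hκ : ((b : ℂ) * (1 - a * Complex.I) / (1 + a ^ 2)).re ≠ 0 := by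
    rw [hre]
    positivity
  exact ⟨_, HopfLCK.hopfDiffeomorph hκ hv, HopfLCK.isBiholomorphism_hopfDiffeomorph hκ hv
    (HopfLCK.mfderiv_spiral_normalForm hJ hv hb h1 h2 rfl)⟩
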